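/- Let $n=2k\ge 2$ be even and let $\theta\in(-\pi/2,\pi/2)$, $s\in\mathbb R$ satisfy $\lambda_s:=s/\sqrt{1+s^2}=\sin\theta$. Let $\mathbb H^n=\{x\in\mathbb R^{1,n}:-x_0^2+x_1^2+\dots+x_n^2=-1,\ x_0>0\}$ with its hyperbolic metric $b$, $V_{(i)}=x_i|_{\mathbb H^n}$, $\mathbb H^n_s=\{V_{(1)}\le s\}$, with boundary $\Sigma_s=\{V_{(1)}=s\}$ and outward unit normal $\eta_s$, and let $\nu=-\eta_s$. Let $\mathcal N_{b,s}=\operatorname{span}_{\mathbb R}\{V_{(0)},V_{(2)},\dots,V_{(n)}\}$ as functions on $\mathbb H^n_s$, with the Lorentzian product $\langle\langle\cdot,\cdot\rangle\rangle_s$ for which this basis is orthonormal, $\langle\langle V_{(0)},V_{(0)}\rangle\rangle_s=1$ and $\langle\langle V_{(j)},V_{(j)}\rangle\rangle_s=-1$ for $j\ge 2$, and let $$\mathcal C^{\uparrow}_{b,s}=\{V\in\mathcal N_{b,s}:\ \langle\langle V,V\rangle\rangle_s=0,\ \langle\langle V,V_{(0)}\rangle\rangle_s>0\}.$$ On the complex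 spinor bundle of $\mathbb H^n_s$ (of rank $2^{k}$), with Levi-Civita connection $\nabla$ and Clifford multiplication $\mathfrak c$, where $\mathfrak c(X)^2=-|X|^2$, let $Q=\mathbf i^{n/2}\mathfrak c(e_1)\cdots\mathfrak c(e_n)$ for a positively oriented orthonormal frame, and along $\Sigma_s$ let $Q_\theta=e^{\mathbf i\theta Q}Q\,\mathfrak c(\nu)$. Fix a sign $\pm$, the same one throughout, and let $\mathcal K^{\pm}_\theta$ be the space of smooth spinors $\Phi$ on $\mathbb H^n_s$ with $$\nabla_X\Phi\pm\tfrac{\mathbf i}{2}\mathfrak c(X)\Phi=0\ \text{ for all tangent vectors } X,\qquad Q_\theta\Phi=\pm\Phi\ \text{ along }\Sigma_s .$$ Such a $\Phi$ is of type I if $|\Phi|^4+\sum_{i=1}^n\langle\mathfrak c(e_i)\Phi,\Phi\rangle^2=0$ on $\mathbb H^n_s$. Put $V_\Phi=|\Phi|^2$. Then: 1. For every $\Phi\in\mathcal K^{\pm}_\theta$ one has $V_\Phi\in\mathcal N_{b,s}$, and $V_\Phi$ solves the static equations $\nabla_b^2V-nVb-V\,\mathrm{Ric}_b=0$ and $\Delta_bV-nV=0$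 on $\mathbb H^n_s$, with $\partial V/\partial\eta_s=\lambda_sV$ along $\Sigma_s$. 2. If $\Phi\in\mathcal K^{\pm}_\theta$ is of type I and $\Phi\not\equiv0$, then $V_\Phi\in\mathcal C^{\uparrow}_{b,s}$. 3. If $n\ge 3$ (hence $n\ge4$), then every $V\in\mathcal C^{\uparrow}_{b,s}$ equals $V_\Phi$ for some $\Phi\in\mathcal K^{\pm}_\theta$ of type I with $\Phi\not\equiv0$. -/

import Mathlib

open scoped ContDiff InnerProductSpace

noncomputable section

namespace HypSpin

/-! ### Riemannian geometry in the coordinates of an open subset of `ℝⁿ` -/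

/-- Coordinate space `ℝⁿ`, in which the Poincaré ball lies. -/
abbrev Coord (n : ℕ) : Type := EuclideanSpace ℝ (Fin n)

/-- The coordinate vector `∂_i`. -/
def coordVec {n : ℕ} (i : Fin n) : Coord n := EuclideanSpace.single i 1

section Riemannian

variable {n : ℕ}

/-- The value `g_y(X, Y)` of the metric with components `g`. -/
def metricVal (g : Coord n → Matrix (Fin n) (Fin n) ℝ) (y X Y : Coord n) : ℝ :=
  ∑ i, ∑ j, g y i j * X i * Y j

/-- The partial derivative `∂_i f` at `y`. -/
def pderiv (f : Coord n → ℝ) (i : Fin n) (y : Coord n) : ℝ := fderiv ℝ f y (coordVec i)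

/-- The partial derivative `∂_i f` of a function that is given on the domain `D`
(which may contain boundary points). -/
def pderivOn (D : Set (Coord n)) (f : Coord n → ℝ) (i : Fin n) (y : Coord n) : ℝ :=
  fderivWithin ℝ f D y (coordVec i)

/-- Christoffel symbols `Γ^l_{ij}` of the Levi-Civita connection. -/
def christoffel (g : Coord n → Matrix (Fin n) (Fin n) ℝ) (l i j : Fin n) (y : Coord n) : ℝ :=
  (1 / 2) * ∑ m, (g y)⁻¹ l m *
    (pderiv (fun z => g z j m) i y + pderiv (fun z => g z i m) j y - pderiv (fun z => g z i j) m y)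

/-- The Ricci tensor `Ric_{ij}`. -/
def ricci (g : Coord n → Matrix (Fin n) (Fin n) ℝ) (i j : Fin n) (y : Coord n) : ℝ :=
  ∑ l, (pderiv (christoffel g l i j) l y - pderiv (christoffel g l i l) j y)
    + ∑ l, ∑ m, (christoffel g l l m y * christoffel g m i j y
        - christoffel g l j m y * christoffel g m i l y)

/-- The covariant derivative `∇_X Y` of a vector field `Y`. -/
def covDeriv (g : Coord n → Matrix (Fin n) (Fin n) ℝ) (X : Coord n) (Y : Coord n → Coord n)
    (y : Coord n) : Coord n :=
  fderiv ℝ Y y X + ∑ l, (∑ i, ∑ j, christoffel g l i j y * X i * Y y j) • coordVec l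

/-- The Hessian `(∇² V)_{ij}` of a function on `D`. -/
def hessianOn (D : Set (Coord n)) (g : Coord n → Matrix (Fin n) (Fin n) ℝ) (V : Coord n → ℝ)
    (i j : Fin n) (y : Coord n) : ℝ :=
  pderivOn D (pderivOn D V j) i y - ∑ l, christoffel g l i j y * pderivOn D V l y

/-- The Laplacian `Δ V = tr_g ∇² V` of a function on `D`. -/
def laplacianOn (D : Set (Coord n)) (g : Coord n → Matrix (Fin n) (Fin n) ℝ) (V : Coord n → ℝ)
    (y : Coord n) : ℝ :=
  ∑ i, ∑ j, (g y)⁻¹ i j * hessianOn D g V i j y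

/-- The gradient of a function. -/
def gradient (g : Coord n → Matrix (Fin n) (Fin n) ℝ) (f : Coord n → ℝ) (y : Coord n) : Coord n :=
  ∑ i, (∑ j, (g y)⁻¹ i j * pderiv f j y) • coordVec i

end Riemannian

/-! ### The complex spinor module of `ℝ^{2k}` -/

/-- The complex spinor space of `ℝ^{2k}`, of dimension `2^k` (the Fock space on `k` generators),
with its standard Hermitian product. -/
abbrev Spinor (k : ℕ) : Type := EuclideanSpace ℂ (Finset (Fin k))

/-- The generator of the Fock space to which the basis vector `e_a` of `ℝ^{2k}` belongs. -/
def pairIndex {k : ℕ} (a : Fin (2 * k)) : Fin k := ⟨a / 2, by omega⟩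

/-- The matrix of Clifford multiplication by the `a`-th vector of the standard orthonormal basis
of `ℝ^{2k}` on the spinor space. -/
def gammaMatrix (k : ℕ) (a : Fin (2 * k)) : Matrix (Finset (Fin k)) (Finset (Fin k)) ℂ :=
  fun A B =>
    if B = symmDiff A {pairIndex a} then
      (-1) ^ (A.filter (fun l => l < pairIndex a)).card *
        (if a.val % 2 = 0 then Complex.I else if pairIndex a ∈ A then 1 else -1)
    else 0

/-- Clifford multiplication by the `a`-th vector of the standard basis. -/
def gamma (k : ℕ) (a : Fin (2 * k)) : Spinor k →L[ℂ] Spinor k :=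
  Matrix.toEuclideanCLM (n := Finset (Fin k)) (𝕜 := ℂ) (gammaMatrix k a)

/-- The chirality operator: the complex volume element `ω = i^{n/2} c(e_1) ⋯ c(e_n)`, `n = 2k`. -/
def chirality (k : ℕ) : Spinor k →L[ℂ] Spinor k :=
  Complex.I ^ k • (List.ofFn (gamma k)).prod

/-! ### The domains `ℍⁿ_s` of hyperbolic space in the Poincaré ball model -/

/-- The conformal factor `Ω(y) = (1 - |y|²) / 2`. -/
def conf {n : ℕ} (y : Coord n) : ℝ := (1 - ‖y‖ ^ 2) / 2

/-- The hyperbolic metric `b = Ω⁻² δ`. -/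
def hypMetric {n : ℕ} (y : Coord n) : Matrix (Fin n) (Fin n) ℝ :=
  (conf y ^ 2)⁻¹ • (1 : Matrix (Fin n) (Fin n) ℝ)

/-- The orthonormal frame `e_a = Ω ∂_a` of the hyperbolic metric. -/
def hypFrame {n : ℕ} (a : Fin n) (y : Coord n) : Coord n := conf y • coordVec a

/-- The restrictions `V_(0), V_(1), …, V_(n)` of the linear coordinates `x_0, x_1, …, x_n` of
Minkowski space to the hyperboloid, in the ball model:
`V_(0) = (1 + |y|²) / (1 - |y|²)` and `V_(j) = 2 y_j / (1 - |y|²)` for `1 ≤ j ≤ n`.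
(The coordinates `y_1, …, y_n` are indexed by `0, …, n - 1` here, so that `j` is `Fin.succ` of
the index of `y_j`.) -/
def potV {n : ℕ} (i : Fin (n + 1)) (y : Coord n) : ℝ :=
  Fin.cases ((1 + ‖y‖ ^ 2) / (1 - ‖y‖ ^ 2)) (fun j => 2 * y j / (1 - ‖y‖ ^ 2)) i

/-- The domain `ℍⁿ_s = {V_(1) ≤ s}`. -/
def hypDomain (n : ℕ) (s : ℝ) : Set (Coord n) := {y | ‖y‖ < 1 ∧ potV 1 y ≤ s}

/-- Its boundary `Σ_s = {V_(1) = s}`. -/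
def hypBoundary (n : ℕ) (s : ℝ) : Set (Coord n) := {y | ‖y‖ < 1 ∧ potV 1 y = s}

/-- The outward unit normal `η_s = ∇V_(1) / |∇V_(1)|` along `Σ_s`. -/
def outNormal {n : ℕ} (y : Coord n) : Coord n :=
  (Real.sqrt (metricVal hypMetric y (gradient hypMetric (potV 1) y)
    (gradient hypMetric (potV 1) y)))⁻¹ • gradient hypMetric (potV 1) y

/-- The principal curvature `λ_s = s / √(1 + s²)` of `Σ_s`. -/
def umbilicity (s : ℝ) : ℝ := s / Real.sqrt (1 + s ^ 2)

/-! ### Static potentials -/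

/-- `V` is a smooth solution on `ℍⁿ_s` of the static equations
`∇²V + Λ V b - V Ric = 0` and `ΔV + Λ V = 0`, with `Λ = -n`, and of the boundary condition
`∂V/∂η = λ_s V` along `Σ_s`. -/
structure SolvesStatic (n : ℕ) (s : ℝ) (V : Coord n → ℝ) : Prop where
  smooth : ContDiffOn ℝ ∞ V (hypDomain n s)
  hessian_eq : ∀ y ∈ hypDomain n s, ∀ i j : Fin n,
    hessianOn (hypDomain n s) hypMetric V i j y + (-(n : ℝ)) * V y * hypMetric y i j
      - V y * ricci hypMetric i j y = 0
  laplacian_eq : ∀ y ∈ hypDomain n s,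
    laplacianOn (hypDomain n s) hypMetric V y + (-(n : ℝ)) * V y = 0
  boundary_eq : ∀ y ∈ hypBoundary n s,
    fderivWithin ℝ V (hypDomain n s) y (outNormal y) - umbilicity s * V y = 0

/-- The indices `0, 2, …, n`. -/
abbrev PotIndex (n : ℕ) : Type := {i : Fin (n + 1) // i ≠ 1}

/-- The space `𝒩_{b,s} = [V_(0), V_(2), …, V_(n)]` of functions on `ℍⁿ_s`. -/
def staticSpace (n : ℕ) (s : ℝ) : Submodule ℝ (hypDomain n s → ℝ) :=
  Submodule.span ℝ (Set.range fun i : PotIndex n => (hypDomain n s).domRestrict (potV i.1))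

/-- The Lorentzian product `⟨⟨ , ⟩⟩_s` on `𝒩_{b,s}`, in the coefficients with respect to
`V_(0), V_(2), …, V_(n)`: this basis is orthonormal, `V_(0)` has square `1`
and the other `V_(j)` have square `-1`. -/
def lorentz {n : ℕ} (p q : PotIndex n → ℝ) : ℝ :=
  ∑ i : PotIndex n, (if i.1 = 0 then 1 else -1) * p i * q i

/-- The future null cone: all `V ∈ 𝒩_{b,s}` with `⟨⟨V, V⟩⟩_s = 0` and `⟨⟨V, V_(0)⟩⟩_s > 0`. -/
def futureCone (n : ℕ) (s : ℝ) : Set (hypDomain n s → ℝ) :=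
  {V | ∃ p : PotIndex n → ℝ,
    V = ∑ i : PotIndex n, p i • (hypDomain n s).domRestrict (potV i.1) ∧
    lorentz p p = 0 ∧ 0 < lorentz p (fun i => if i.1 = 0 then 1 else 0)}

/-! ### Spinors on `ℍⁿ_s`, `n = 2k`

The ball is contractible, so it has a single spin structure, and the frame `e_a = Ω ∂_a`
trivializes the spinor bundle: a spinor field is a map from the domain to the spinor space, on
which `e_a` acts as the `a`-th Clifford generator. Only the values on the domain matter. -/

variable {k : ℕ}

/-- Clifford multiplication `c(X)` by a tangent vector `X` at `y`. -/
def cliff (y X : Coord (2 * k)) : Spinor k →L[ℂ] Spinor k :=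
  ∑ a, ((metricVal hypMetric y X (hypFrame a y) : ℝ) : ℂ) • gamma k a

/-- The lift of the Levi-Civita connection to spinors,
`∇_X Φ = X(Φ) + (1/4) ∑_{a,b} b(∇_X e_a, e_b) c(e_a) c(e_b) Φ`. -/
def spinDeriv (s : ℝ) (Φ : Coord (2 * k) → Spinor k) (X y : Coord (2 * k)) : Spinor k :=
  fderivWithin ℝ Φ (hypDomain (2 * k) s) y X
    + (1 / 4 : ℂ) • ∑ a, ∑ b,
      ((metricVal hypMetric y (covDeriv hypMetric X (hypFrame a) y) (hypFrame b y) : ℝ) : ℂ) •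
        gamma k a (gamma k b (Φ y))

/-- The `θ`-boundary operator `Q_θ = e^{iθQ} Q c(ν)` at `y ∈ Σ_s`, where `ν = -η_s` is the inward
unit normal. -/
def thetaOp (θ : ℝ) (y : Coord (2 * k)) : Spinor k →L[ℂ] Spinor k :=
  NormedSpace.exp ((Complex.I * (θ : ℂ)) • chirality k) * chirality k * cliff y (-outNormal y)

/-- The space `𝒦^{b,±,(±)_θ}` of imaginary Killing spinors on `ℍⁿ_s`, `n = 2k`, which satisfy the
`θ`-boundary condition; the sign `ε = ±1` is the same in both equations. -/
structure IsThetaKilling (ε : ℤˣ) (θ s : ℝ) (Φ : Coord (2 * k) → Spinor k) : Prop where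
  smooth : ContDiffOn ℝ ∞ Φ (hypDomain (2 * k) s)
  killing : ∀ y ∈ hypDomain (2 * k) s, ∀ X : Coord (2 * k),
    spinDeriv s Φ X y + (((ε : ℤ) : ℂ) * (Complex.I / 2)) • cliff y X (Φ y) = 0
  boundary : ∀ y ∈ hypBoundary (2 * k) s, thetaOp θ y (Φ y) = ((ε : ℤ) : ℂ) • Φ y

/-- `Φ` does not vanish identically on `ℍⁿ_s`. -/
def IsNontrivial (s : ℝ) (Φ : Coord (2 * k) → Spinor k) : Prop :=
  ∃ y ∈ hypDomain (2 * k) s, Φ y ≠ 0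

/-- `Φ` is of type I: `q_Φ = |Φ|⁴ + ∑_a ⟨c(e_a) Φ, Φ⟩²` vanishes on `ℍⁿ_s`. -/
def IsTypeI (s : ℝ) (Φ : Coord (2 * k) → Spinor k) : Prop :=
  ∀ y ∈ hypDomain (2 * k) s,
    ((‖Φ y‖ : ℝ) : ℂ) ^ 4 + ∑ a, ⟪cliff y (hypFrame a y) (Φ y), Φ y⟫_ℂ ^ 2 = 0

/-- The function `V_Φ = |Φ|²`. -/
def normSqFun (Φ : Coord (2 * k) → Spinor k) (y : Coord (2 * k)) : ℝ := ‖Φ y‖ ^ 2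

end HypSpin

end

open HypSpin

open scoped ContDiff InnerProductSpace

noncomputable section

namespace HypSpin

/-! ### The Clifford relations of the Fock space matrices -/

/-! In the frame `e_a = Ω ∂_a` of the Poincaré ball everything becomes explicit. Put J = ±i and
write c for Euclidean Clifford multiplication. The imaginary Killing spinors are exactly Ω^{-1/2}(1
- J c(y))u with u constant (`killingSpinor_killing`, `exists_eq_killingSpinor`). Along Σ_s the
defect of the θ-boundary condition is an invertible operator applied to Qu ± c(∂_1)u
(`thetaOp_killingSpinor_sub`). Hence the condition on Φ is the algebraic condition Qu ± c(∂_1)u = 0,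
in which neither the boundary point nor θ occurs.

Let ξ(u) be the vector with components ⟨i c(∂_a)u, u⟩ (`spinVector`). Then |Φ|² = A V_(0) + ∑ B_j
V_(j) with A = 2|u|² and B = ∓2 ξ(u) (`normSqFun_killingSpinor`). The boundary condition forces ξ(u)
⊥ ∂_1, so V_(1) does not occur. The static equations follow from ∇²V = V b and Ric = -(n-1) b, the
Robin condition from B_1 = 0. The type I defect of Φ is, up to a positive constant, |u|⁴ - |ξ(u)|²
(`typeI_at_killingSpinor_iff`), so type I means that (A, B) is null.

Conversely, for a unit vector v ⊥ ∂_1 the Hermitian involution i c(v) preserves the space of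
admissible u, and an eigenvector for +1 has ξ(u) = |u|² v. When n ≥ 3 there is w ≠ 0 orthogonal to v
and ∂_1; i c(w) exchanges the two eigenspaces, so +1 occurs (`exists_boundary_spinor_hgam_eq`).
Rescaling u reaches every future null vector. -/

/-- The sign `(-1)^{#{l ∈ A : l < p}}`. -/
def fockSign {k : ℕ} (p : Fin k) (A : Finset (Fin k)) : ℂ :=
  (-1) ^ (A.filter (fun l => l < p)).card

/-- The non-zero entry of `gammaMatrix k a` in the row `A`. -/
def gammaCoeff {k : ℕ} (a : Fin (2 * k)) (A : Finset (Fin k)) : ℂ :=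
  fockSign (pairIndex a) A *
    (if a.val % 2 = 0 then Complex.I else if pairIndex a ∈ A then 1 else -1)

lemma gammaMatrix_apply {k : ℕ} (a : Fin (2 * k)) (A B : Finset (Fin k)) :
    gammaMatrix k a A B = if B = symmDiff A {pairIndex a} then gammaCoeff a A else 0 := rfl

lemma symmDiff_singleton_of_mem {α : Type*} [DecidableEq α] {A : Finset α} {q : α} (h : q ∈ A) :
    symmDiff A {q} = A.erase q := by
  ext x; simp only [Finset.mem_symmDiff, Finset.mem_singleton, Finset.mem_erase]; grind

lemma symmDiff_singleton_of_notMem {α : Type*} [DecidableEq α] {A : Finset α} {q : α}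
    (h : q ∉ A) : symmDiff A {q} = insert q A := by
  ext x; simp only [Finset.mem_symmDiff, Finset.mem_singleton, Finset.mem_insert]; grind

lemma mem_symmDiff_singleton {α : Type*} [DecidableEq α] {A : Finset α} {p q : α} :
    p ∈ symmDiff A {q} ↔ if p = q then p ∉ A else p ∈ A := by
  simp only [Finset.mem_symmDiff, Finset.mem_singleton]; grind

lemma fockSign_symmDiff_of_lt {k : ℕ} {p q : Fin k} (h : q < p) (A : Finset (Fin k)) :
    fockSign p (symmDiff A {q}) = -fockSign p A := by
  by_cases hq : q ∈ A
  · have hm : q ∈ A.filter (fun l => l < p) := by simp [hq, h]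
    have hc := Finset.card_erase_add_one hm
    simp only [fockSign]
    rw [symmDiff_singleton_of_mem hq, Finset.filter_erase, ← hc, pow_succ]
    ring
  · have hm : q ∉ A.filter (fun l => l < p) := by simp [hq]
    simp only [fockSign]
    rw [symmDiff_singleton_of_notMem hq, Finset.filter_insert, if_pos h,
      Finset.card_insert_of_notMem hm, pow_succ]
    ring

lemma fockSign_symmDiff_of_not_lt {k : ℕ} {p q : Fin k} (h : ¬ q < p) (A : Finset (Fin k)) :
    fockSign p (symmDiff A {q}) = fockSign p A := by
  have : (symmDiff A {q}).filter (fun l => l < p) = A.filter (fun l => l < p) := by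
    ext x
    simp only [Finset.mem_filter, mem_symmDiff_singleton]
    by_cases hx : x = q
    · subst hx; simp [h]
    · simp [hx]
  simp only [fockSign, this]

lemma fockSign_mul_self {k : ℕ} (p : Fin k) (A : Finset (Fin k)) :
    fockSign p A * fockSign p A = 1 := by
  simp only [fockSign, ← mul_pow]; simp

lemma fockSign_star {k : ℕ} (p : Fin k) (A : Finset (Fin k)) :
    star (fockSign p A) = fockSign p A := by
  simp [fockSign]

lemma gammaMatrix_mul_apply {k : ℕ} (a b : Fin (2 * k)) (A C : Finset (Fin k)) :
    (gammaMatrix k a * gammaMatrix k b) A C =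
      if C = symmDiff (symmDiff A {pairIndex a}) {pairIndex b} then
        gammaCoeff a A * gammaCoeff b (symmDiff A {pairIndex a}) else 0 := by
  rw [Matrix.mul_apply, Finset.sum_eq_single (symmDiff A {pairIndex a})]
  · simp [gammaMatrix_apply]
  · intro B _ hB
    rw [gammaMatrix_apply, if_neg hB, zero_mul]
  · simp

/-- The Fock sign counts only l < p, so toggling p leaves it alone. What remains is i · i for even
`a` and 1 · (-1) for odd `a`. -/
lemma gammaCoeff_mul_self {k : ℕ} (a : Fin (2 * k)) (A : Finset (Fin k)) :
    gammaCoeff a A * gammaCoeff a (symmDiff A {pairIndex a}) = -1 := by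
  simp only [gammaCoeff, fockSign_symmDiff_of_not_lt (lt_irrefl (pairIndex a)),
    mem_symmDiff_singleton, if_true]
  rw [mul_mul_mul_comm, fockSign_mul_self]
  by_cases h : a.val % 2 = 0
  · simp [h]
  · by_cases h' : pairIndex a ∈ A <;> simp [h, h']

lemma gammaMatrix_mul_self {k : ℕ} (a : Fin (2 * k)) :
    gammaMatrix k a * gammaMatrix k a = -1 := by
  ext A C
  rw [gammaMatrix_mul_apply, symmDiff_symmDiff_cancel_right, gammaCoeff_mul_self]
  by_cases h : C = A
  · simp [h]
  · simp [h, Matrix.one_apply_ne (Ne.symm h)]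

/-- For different pairs, toggling the smaller index flips the Fock sign of the larger one and not
conversely. Within one pair, one generator has the constant factor i and the other a sign that
changes when the pair is toggled. -/
lemma gammaCoeff_anticomm {k : ℕ} {a b : Fin (2 * k)} (hab : a ≠ b) (A : Finset (Fin k)) :
    gammaCoeff a A * gammaCoeff b (symmDiff A {pairIndex a}) =
      -(gammaCoeff b A * gammaCoeff a (symmDiff A {pairIndex b})) := by
  simp only [gammaCoeff, mem_symmDiff_singleton]
  rcases lt_trichotomy (pairIndex a) (pairIndex b) with h | h | h
  · simp only [fockSign_symmDiff_of_lt h, fockSign_symmDiff_of_not_lt h.not_gt, h.ne, h.ne',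
      if_false]
    ring
  · have h2 : a.val / 2 = b.val / 2 := by simpa [pairIndex] using h
    have hne : a.val ≠ b.val := fun e => hab (Fin.ext e)
    simp only [h, fockSign_symmDiff_of_not_lt (lt_irrefl _), if_true]
    rcases Nat.mod_two_eq_zero_or_one a.val with ha | ha <;>
      rcases Nat.mod_two_eq_zero_or_one b.val with hb | hb
    · omega
    · by_cases hm : pairIndex b ∈ A <;> simp [ha, hb, hm] <;> ring
    · by_cases hm : pairIndex b ∈ A <;> simp [ha, hb, hm] <;> ring
    · omega
  · simp only [fockSign_symmDiff_of_lt h, fockSign_symmDiff_of_not_lt h.not_gt, h.ne, h.ne',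
      if_false]
    ring

lemma gammaMatrix_anticomm {k : ℕ} {a b : Fin (2 * k)} (hab : a ≠ b) :
    gammaMatrix k a * gammaMatrix k b = -(gammaMatrix k b * gammaMatrix k a) := by
  ext A C
  rw [Matrix.neg_apply, gammaMatrix_mul_apply, gammaMatrix_mul_apply, gammaCoeff_anticomm hab,
    symmDiff_right_comm]
  split_ifs <;> simp

lemma gammaMatrix_star {k : ℕ} (a : Fin (2 * k)) : star (gammaMatrix k a) = -gammaMatrix k a := by
  ext A C
  rw [Matrix.star_apply, Matrix.neg_apply, gammaMatrix_apply, gammaMatrix_apply]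
  by_cases h : C = symmDiff A {pairIndex a}
  · have h' : A = symmDiff C {pairIndex a} := by rw [h, symmDiff_symmDiff_cancel_right]
    rw [if_pos h, if_pos h', h]
    simp only [gammaCoeff, mem_symmDiff_singleton, fockSign_symmDiff_of_not_lt (lt_irrefl _),
      star_mul', fockSign_star]
    by_cases h0 : a.val % 2 = 0
    · simp [h0]
    · by_cases h1 : pairIndex a ∈ A <;> simp [h0, h1]
  · have h' : A ≠ symmDiff C {pairIndex a} := by
      rintro rfl; simp [symmDiff_symmDiff_cancel_right] at h
    simp [if_neg h, if_neg h']

lemma gamma_mul_self {k : ℕ} (a : Fin (2 * k)) : gamma k a * gamma k a = -1 := by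
  simp only [gamma, ← map_mul, gammaMatrix_mul_self, map_neg, map_one]

lemma gamma_anticomm {k : ℕ} {a b : Fin (2 * k)} (hab : a ≠ b) :
    gamma k a * gamma k b = -(gamma k b * gamma k a) := by
  simp only [gamma, ← map_mul, ← map_neg, gammaMatrix_anticomm hab]

lemma gamma_star {k : ℕ} (a : Fin (2 * k)) : star (gamma k a) = -gamma k a := by
  simp only [gamma, ← map_star, gammaMatrix_star, map_neg]

/-! ### The chirality operator -/

/-- The sign `±1` by which the chirality operator acts on the basis vector of `A`. -/
def chiralSign {k : ℕ} (A : Finset (Fin k)) : ℂ := ∏ p : Fin k, if p ∈ A then 1 else -1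

/-- The two generators of a pair toggle the same element, so their product is diagonal; this is what
makes the volume element computable. -/
lemma I_mul_gammaMatrix_pair {k : ℕ} (p : Fin k) (h0 : 2 * p.val < 2 * k)
    (h1 : 2 * p.val + 1 < 2 * k) :
    gammaMatrix k ⟨2 * p.val, h0⟩ * gammaMatrix k ⟨2 * p.val + 1, h1⟩ =
      Matrix.diagonal (fun A => -Complex.I * if p ∈ A then 1 else -1) := by
  have e0 : pairIndex (⟨2 * p.val, h0⟩ : Fin (2 * k)) = p := by
    ext; simp [pairIndex]
  have e1 : pairIndex (⟨2 * p.val + 1, h1⟩ : Fin (2 * k)) = p := by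
    ext; simp only [pairIndex]; omega
  ext A C
  rw [gammaMatrix_mul_apply, e0, e1, symmDiff_symmDiff_cancel_right]
  by_cases h : C = A
  · subst h
    rw [if_pos rfl, Matrix.diagonal_apply_eq]
    simp only [gammaCoeff, e0, e1, fockSign_symmDiff_of_not_lt (lt_irrefl p),
      mem_symmDiff_singleton, if_true]
    rw [mul_mul_mul_comm, fockSign_mul_self]
    by_cases hm : p ∈ C <;> simp [hm]
  · rw [if_neg h, Matrix.diagonal_apply_ne _ (Ne.symm h)]

lemma chirality_eq (k : ℕ) : chirality k =
    Matrix.toEuclideanCLM (n := Finset (Fin k)) (𝕜 := ℂ) (Matrix.diagonal chiralSign) := by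
  have h1 : (List.ofFn (gammaMatrix k)).prod = Matrix.diagonal
      (∏ p : Fin k, fun A : Finset (Fin k) => -Complex.I * if p ∈ A then 1 else -1) := by
    -- The product over 2k generators is regrouped into k consecutive pairs.
    rw [List.ofFn_mul', List.prod_flatten, ← List.prod_ofFn]
    have := map_list_prod (Matrix.diagonalRingHom (Finset (Fin k)) ℂ) (List.ofFn
      fun p : Fin k => fun A : Finset (Fin k) => -Complex.I * if p ∈ A then 1 else -1)
    simp only [Matrix.diagonalRingHom_apply] at this
    rw [this, List.map_ofFn, List.map_ofFn]
    congr 2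
    ext1 p
    simp only [Function.comp_apply, List.ofFn_succ, List.ofFn_zero, List.prod_cons, List.prod_nil,
      mul_one]
    simpa using I_mul_gammaMatrix_pair p (by omega) (by omega)
  have h2 : (List.ofFn (gamma k)).prod = Matrix.toEuclideanCLM (n := Finset (Fin k)) (𝕜 := ℂ)
      (List.ofFn (gammaMatrix k)).prod := by
    rw [map_list_prod, List.map_ofFn]; rfl
  rw [chirality, h2, h1, ← map_smul]
  congr 1
  rw [← Matrix.diagonal_smul]
  congr 1
  ext A
  simp only [Pi.smul_apply, Finset.prod_apply, smul_eq_mul, chiralSign, Finset.prod_mul_distrib,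
    Finset.prod_const, Finset.card_univ, Fintype.card_fin]
  -- The normalisation i^k cancels the (-i)^k coming from the pairs.
  rw [← mul_assoc, ← mul_pow]
  simp

lemma chiralSign_mul_self {k : ℕ} (A : Finset (Fin k)) : chiralSign A * chiralSign A = 1 := by
  rw [chiralSign, ← Finset.prod_mul_distrib]
  refine Finset.prod_eq_one fun p _ => ?_
  split_ifs <;> simp

lemma chiralSign_star {k : ℕ} (A : Finset (Fin k)) : star (chiralSign A) = chiralSign A := by
  simp only [chiralSign, star_prod, RCLike.star_def]
  refine Finset.prod_congr rfl fun p _ => ?_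
  split_ifs <;> simp

lemma chiralSign_symmDiff {k : ℕ} (A : Finset (Fin k)) (q : Fin k) :
    chiralSign (symmDiff A {q}) = -chiralSign A := by
  rw [chiralSign, chiralSign, ← Finset.mul_prod_erase _ _ (Finset.mem_univ q),
    ← Finset.mul_prod_erase (a := q) _ _ (Finset.mem_univ q), ← neg_mul]
  congr 1
  · simp only [mem_symmDiff_singleton, if_true]
    by_cases h : q ∈ A <;> simp [h]
  · refine Finset.prod_congr rfl fun p hp => ?_
    simp only [mem_symmDiff_singleton, if_neg (Finset.ne_of_mem_erase hp)]

lemma chirality_mul_self (k : ℕ) : chirality k * chirality k = 1 := by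
  rw [chirality_eq, ← map_mul, Matrix.diagonal_mul_diagonal]
  simp [chiralSign_mul_self]

lemma chirality_star (k : ℕ) : star (chirality k) = chirality k := by
  rw [chirality_eq, ← map_star, Matrix.star_eq_conjTranspose, Matrix.diagonal_conjTranspose]
  congr 2
  ext A
  simp [chiralSign_star]

lemma chirality_mul_gamma {k : ℕ} (a : Fin (2 * k)) :
    chirality k * gamma k a = -(gamma k a * chirality k) := by
  rw [chirality_eq, gamma, ← map_mul, ← map_mul, ← map_neg]
  congr 1
  ext A B
  rw [Matrix.diagonal_mul, Matrix.neg_apply, Matrix.mul_diagonal, gammaMatrix_apply]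
  split_ifs with h
  · rw [h, chiralSign_symmDiff]; ring
  · simp

/-- Euler's formula for an involution. -/
lemma exp_I_smul_of_mul_self {A : Type*} [NormedRing A] [NormedAlgebra ℂ A] [CompleteSpace A]
    {Q : A} (hQ : Q * Q = 1) (θ : ℝ) :
    NormedSpace.exp ((Complex.I * (θ : ℂ)) • Q) =
      (Real.cos θ : ℂ) • (1 : A) + (Complex.I * (Real.sin θ : ℂ)) • Q := by
  have hQ2 : ∀ n, Q ^ (2 * n) = 1 := fun n => by rw [pow_mul, pow_two, hQ, one_pow]
  have h := NormedSpace.exp_series_hasSum_exp' (𝕂 := ℂ) ((Complex.I * (θ : ℂ)) • Q)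
  have hc := (Complex.hasSum_cos' (θ : ℂ)).smul_const (1 : A)
  have hs := ((Complex.hasSum_sin' (θ : ℂ)).mul_left Complex.I).smul_const Q
  rw [Complex.ofReal_cos, Complex.ofReal_sin]
  -- Even powers of Q are 1 and odd ones are Q, so the exponential series splits into those of
  -- cosine and sine.
  refine h.unique (HasSum.even_add_odd ?_ ?_)
  · convert hc using 2 with n
    rw [smul_pow, hQ2, smul_smul]
    congr 1
    rw [mul_comm Complex.I]; field_simp
  · convert hs using 2 with n
    rw [smul_pow, pow_succ Q, hQ2, smul_smul, one_mul]
    congr 1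
    rw [mul_comm Complex.I]; field_simp

/-! ### Clifford multiplication by a vector of `ℝ^{2k}` -/

/-! The remaining identities are stated for the action on spinors. -/

lemma gamma_gamma_self {k : ℕ} (a : Fin (2 * k)) (x : Spinor k) :
    gamma k a (gamma k a x) = -x :=
  DFunLike.congr_fun (gamma_mul_self a) x

lemma gamma_gamma_anticomm {k : ℕ} {a b : Fin (2 * k)} (hab : a ≠ b) (x : Spinor k) :
    gamma k a (gamma k b x) = -gamma k b (gamma k a x) :=
  DFunLike.congr_fun (gamma_anticomm hab) x

lemma inner_gamma_left {k : ℕ} (a : Fin (2 * k)) (x y : Spinor k) :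
    ⟪gamma k a x, y⟫_ℂ = -⟪x, gamma k a y⟫_ℂ := by
  rw [← ContinuousLinearMap.adjoint_inner_right, ← ContinuousLinearMap.star_eq_adjoint, gamma_star,
    neg_apply, inner_neg_right]

lemma chirality_chirality {k : ℕ} (x : Spinor k) : chirality k (chirality k x) = x :=
  DFunLike.congr_fun (chirality_mul_self k) x

lemma chirality_gamma {k : ℕ} (a : Fin (2 * k)) (x : Spinor k) :
    chirality k (gamma k a x) = -gamma k a (chirality k x) :=
  DFunLike.congr_fun (chirality_mul_gamma a) x

lemma inner_chirality_left {k : ℕ} (x y : Spinor k) :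
    ⟪chirality k x, y⟫_ℂ = ⟪x, chirality k y⟫_ℂ := by
  rw [← ContinuousLinearMap.adjoint_inner_right, ← ContinuousLinearMap.star_eq_adjoint,
    chirality_star]

lemma exp_chirality_apply {k : ℕ} (θ : ℝ) (x : Spinor k) :
    NormedSpace.exp ((Complex.I * (θ : ℂ)) • chirality k) x =
      (Real.cos θ : ℂ) • x + (Complex.I * (Real.sin θ : ℂ)) • chirality k x :=
  DFunLike.congr_fun (exp_I_smul_of_mul_self (chirality_mul_self k) θ) x

/-- Clifford multiplication by a vector of Euclidean space. -/
def gam (k : ℕ) (v : Coord (2 * k)) : Spinor k →L[ℂ] Spinor k :=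
  ∑ a, ((v a : ℝ) : ℂ) • gamma k a

lemma gam_apply {k : ℕ} (v : Coord (2 * k)) (x : Spinor k) :
    gam k v x = ∑ a, ((v a : ℝ) : ℂ) • gamma k a x := by
  simp [gam]

lemma gam_coordVec {k : ℕ} (a : Fin (2 * k)) (x : Spinor k) :
    gam k (coordVec a) x = gamma k a x := by
  rw [gam_apply, Finset.sum_eq_single a] <;> simp +contextual [coordVec]

lemma gam_add {k : ℕ} (v w : Coord (2 * k)) (x : Spinor k) :
    gam k (v + w) x = gam k v x + gam k w x := by
  simp [gam_apply, add_smul, Finset.sum_add_distrib]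

lemma gam_smul {k : ℕ} (r : ℝ) (v : Coord (2 * k)) (x : Spinor k) :
    gam k (r • v) x = (r : ℂ) • gam k v x := by
  simp only [gam_apply, Finset.smul_sum, smul_smul, PiLp.smul_apply, smul_eq_mul,
    Complex.ofReal_mul]

lemma gam_gam_add {k : ℕ} (v w : Coord (2 * k)) (x : Spinor k) :
    gam k v (gam k w x) + gam k w (gam k v x) = ((-2 * ⟪v, w⟫_ℝ : ℝ) : ℂ) • x := by
  have key : ∀ a b, gamma k a (gamma k b x) + gamma k b (gamma k a x) =
      if a = b then (-2 : ℂ) • x else 0 := by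
    intro a b
    split_ifs with h
    · subst h; rw [gamma_gamma_self]; module
    · rw [gamma_gamma_anticomm h]; simp
  have e : gam k v (gam k w x) + gam k w (gam k v x) =
      ∑ a, ∑ b, (((v a : ℝ) : ℂ) * ((w b : ℝ) : ℂ)) •
        (gamma k a (gamma k b x) + gamma k b (gamma k a x)) := by
    simp only [gam_apply, map_sum, map_smul, Finset.smul_sum, smul_add, smul_smul,
      Finset.sum_add_distrib]
    congr 1
    rw [Finset.sum_comm]
    simp only [mul_comm]
  rw [e]
  simp only [key, smul_ite, smul_zero, Finset.sum_ite_eq, Finset.mem_univ, if_true, smul_smul,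
    ← Finset.sum_smul]
  congr 1
  simp only [PiLp.inner_apply, RCLike.inner_apply, conj_trivial, Complex.ofReal_sum,
    Complex.ofReal_mul, Finset.mul_sum]
  refine Finset.sum_congr rfl fun _ _ => ?_
  push_cast
  ring

lemma gam_gam_self {k : ℕ} (v : Coord (2 * k)) (x : Spinor k) :
    gam k v (gam k v x) = -(((‖v‖ ^ 2 : ℝ) : ℂ) • x) := by
  have h := gam_gam_add v v x
  rw [real_inner_self_eq_norm_sq] at h
  have h2 : (2 : ℂ) • gam k v (gam k v x) = (2 : ℂ) • -(((‖v‖ ^ 2 : ℝ) : ℂ) • x) := by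
    rw [two_smul, h]; push_cast; module
  exact smul_right_injective _ (two_ne_zero (α := ℂ)) h2

lemma inner_gam_left {k : ℕ} (v : Coord (2 * k)) (x y : Spinor k) :
    ⟪gam k v x, y⟫_ℂ = -⟪x, gam k v y⟫_ℂ := by
  simp only [gam_apply, sum_inner, inner_sum, inner_smul_left, inner_smul_right, inner_gamma_left,
    Complex.conj_ofReal, mul_neg, Finset.sum_neg_distrib]

lemma chirality_gam {k : ℕ} (v : Coord (2 * k)) (x : Spinor k) :
    chirality k (gam k v x) = -gam k v (chirality k x) := by
  simp only [gam_apply, map_sum, map_smul, chirality_gamma, smul_neg, Finset.sum_neg_distrib]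

/-! ### The hyperbolic metric of the ball: Christoffel symbols and curvature -/

section Metric

variable {n : ℕ}

lemma conf_pos {y : Coord n} (hy : ‖y‖ < 1) : 0 < conf y := by
  have : ‖y‖ ^ 2 < 1 := by nlinarith [norm_nonneg y]
  simp only [conf]; linarith

lemma norm_sq_eq_conf (y : Coord n) : ‖y‖ ^ 2 = 1 - 2 * conf y := by
  simp only [conf]; ring

lemma contDiff_conf : ContDiff ℝ ∞ (conf : Coord n → ℝ) := by
  have := contDiff_norm_sq (n := ∞) ℝ (E := Coord n)
  unfold conf
  fun_prop

lemma hasFDerivAt_conf (y : Coord n) : HasFDerivAt conf (-(innerSL ℝ y)) y := by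
  have h := ((hasStrictFDerivAt_norm_sq y).hasFDerivAt.const_sub 1).mul_const (1 / 2 : ℝ)
  refine (h.congr_fderiv ?_).congr_of_eventuallyEq (Filter.Eventually.of_forall fun z => ?_)
  · ext v; simp
  · simp only [conf]; ring

lemma hasFDerivAt_coord (i : Fin n) (y : Coord n) :
    HasFDerivAt (fun z : Coord n => z i) (EuclideanSpace.proj i : Coord n →L[ℝ] ℝ) y :=
  (EuclideanSpace.proj i : Coord n →L[ℝ] ℝ).hasFDerivAt

lemma coordVec_apply (i j : Fin n) : (coordVec i : Coord n) j = if j = i then 1 else 0 := by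
  simp [coordVec]

lemma inner_coordVec (y : Coord n) (i : Fin n) : ⟪y, coordVec i⟫_ℝ = y i := by
  simp [coordVec, EuclideanSpace.inner_single_right]

lemma proj_coordVec (i m : Fin n) :
    (EuclideanSpace.proj i : Coord n →L[ℝ] ℝ) (coordVec m) = if i = m then 1 else 0 :=
  coordVec_apply m i

lemma hasFDerivAt_inv_conf {y : Coord n} (hy : conf y ≠ 0) :
    HasFDerivAt (fun z : Coord n => (conf z)⁻¹) ((conf y ^ 2)⁻¹ • innerSL ℝ y) y :=
  ((hasDerivAt_inv hy).comp_hasFDerivAt y (hasFDerivAt_conf y)).congr_fderiv (by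
    ext v; simp)

lemma norm_sq_eq_sum (y : Coord n) : ∑ i, y i * y i = ‖y‖ ^ 2 := by
  rw [EuclideanSpace.norm_sq_eq]
  exact Finset.sum_congr rfl fun i _ => by rw [Real.norm_eq_abs, sq_abs, sq]

lemma inner_eq_sum (x y : Coord n) : ⟪x, y⟫_ℝ = ∑ i, x i * y i := by
  simp [PiLp.inner_apply, mul_comm]

lemma metricVal_hypMetric (y X Y : Coord n) :
    metricVal hypMetric y X Y = (conf y ^ 2)⁻¹ * ⟪X, Y⟫_ℝ := by
  simp only [metricVal, hypMetric, Matrix.smul_apply, Matrix.one_apply, smul_eq_mul, mul_ite,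
    mul_one, mul_zero, ite_mul, zero_mul, Finset.sum_ite_eq, Finset.mem_univ, if_true,
    inner_eq_sum, Finset.mul_sum, mul_assoc]

lemma hypMetric_inv {y : Coord n} (hy : conf y ≠ 0) :
    (hypMetric y)⁻¹ = (conf y ^ 2) • (1 : Matrix (Fin n) (Fin n) ℝ) := by
  refine Matrix.inv_eq_right_inv ?_
  rw [hypMetric, smul_mul_smul_comm, inv_mul_cancel₀ (pow_ne_zero 2 hy), one_smul, one_mul]

lemma pderiv_hypMetric (i j m : Fin n) {y : Coord n} (hy : conf y ≠ 0) :
    pderiv (fun z => hypMetric z j m) i y =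
      (if j = m then 1 else 0) * (2 * y i / conf y ^ 3) := by
  have h1 := (hasFDerivAt_inv_conf hy).pow 2
  have h2 := h1.mul_const (if j = m then (1 : ℝ) else 0)
  have e : (fun z : Coord n => hypMetric z j m) =
      fun z => (conf z)⁻¹ ^ 2 * (if j = m then (1 : ℝ) else 0) := by
    ext z; simp [hypMetric, Matrix.one_apply]
  rw [pderiv, e, h2.fderiv]
  generalize (if j = m then (1 : ℝ) else 0) = d
  simp only [smul_apply, innerSL_apply_apply, inner_coordVec, smul_eq_mul, Nat.add_one_sub_one,
    pow_one, nsmul_eq_mul, Nat.cast_ofNat]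
  field_simp

/-- The metric is e^{2f} δ with f = -log Ω and ∂_i f = y_i / Ω; these are the symbols of a
conformally flat metric. -/
lemma christoffel_hypMetric (l i j : Fin n) {y : Coord n} (hy : conf y ≠ 0) :
    christoffel hypMetric l i j y =
      ((if l = j then 1 else 0) * y i + (if l = i then 1 else 0) * y j
        - (if i = j then 1 else 0) * y l) / conf y := by
  simp only [christoffel, pderiv_hypMetric _ _ _ hy, hypMetric_inv hy, Matrix.smul_apply,
    Matrix.one_apply, smul_eq_mul, mul_ite, mul_one, mul_zero, ite_mul, zero_mul,
    Finset.sum_ite_eq, Finset.mem_univ, if_true, eq_comm (a := j) (b := l),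
    eq_comm (a := i) (b := l), one_mul]
  split_ifs <;> field_simp <;> ring

lemma pderiv_christoffel (l i j m : Fin n) {y : Coord n} (hy : conf y ≠ 0) :
    pderiv (christoffel hypMetric l i j) m y =
      ((if l = j then 1 else 0) * (if i = m then 1 else 0)
        + (if l = i then 1 else 0) * (if j = m then 1 else 0)
        - (if i = j then 1 else 0) * (if l = m then 1 else 0)) / conf y
      + ((if l = j then 1 else 0) * y i + (if l = i then 1 else 0) * y j
        - (if i = j then 1 else 0) * y l) * y m / conf y ^ 2 := by
  have hn : ∀ᶠ z in nhds y, conf z ≠ 0 := contDiff_conf.continuous.continuousAt.eventually_ne hy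
  have he : christoffel hypMetric l i j =ᶠ[nhds y] fun z =>
      ((if l = j then (1 : ℝ) else 0) * z i + (if l = i then (1 : ℝ) else 0) * z j
        - (if i = j then (1 : ℝ) else 0) * z l) * (conf z)⁻¹ := by
    filter_upwards [hn] with z hz
    rw [christoffel_hypMetric l i j hz, div_eq_mul_inv]
  have h1 := (((hasFDerivAt_coord i y).const_mul (if l = j then (1 : ℝ) else 0)).add
    ((hasFDerivAt_coord j y).const_mul (if l = i then (1 : ℝ) else 0))).sub
    ((hasFDerivAt_coord l y).const_mul (if i = j then (1 : ℝ) else 0))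
  have h2 := h1.mul (hasFDerivAt_inv_conf hy)
  rw [pderiv, he.fderiv_eq]
  refine (congrFun (congrArg _ h2.fderiv) _).trans ?_
  simp only [smul_apply, add_apply, sub_apply, innerSL_apply_apply, inner_coordVec,
    smul_eq_mul, proj_coordVec, Pi.add_apply, Pi.sub_apply]
  field_simp
  ring

lemma sum_christoffel_trace (m : Fin n) {y : Coord n} (hy : conf y ≠ 0) :
    ∑ l, christoffel hypMetric l l m y = n * y m / conf y := by
  simp only [christoffel_hypMetric _ _ _ hy, ← Finset.sum_div]
  congr 1
  simp

/-- Hyperbolic space is Einstein. -/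
lemma ricci_hypMetric (i j : Fin n) {y : Coord n} (hy : conf y ≠ 0) :
    ricci hypMetric i j y = -((n : ℝ) - 1) * hypMetric y i j := by
  have hS : ∑ x, y x * (conf y)⁻¹ * (y x * (conf y)⁻¹) = (∑ x, y x * y x) * (conf y ^ 2)⁻¹ := by
    rw [Finset.sum_mul]
    exact Finset.sum_congr rfl fun x _ => by field_simp
  have hS' : ∑ x, n * y x * (conf y)⁻¹ * (y x * (conf y)⁻¹) =
      n * (∑ x, y x * y x) * (conf y ^ 2)⁻¹ := by
    rw [Finset.mul_sum, Finset.sum_mul]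
    exact Finset.sum_congr rfl fun x _ => by field_simp
  have h1 : ∑ l, (pderiv (christoffel hypMetric l i j) l y -
      pderiv (christoffel hypMetric l i l) j y) =
      (2 - 2 * n) * (if i = j then 1 else 0) / conf y
      + (2 * y i * y j - (if i = j then 1 else 0) * ‖y‖ ^ 2 - n * y i * y j) / conf y ^ 2 := by
    simp only [pderiv_christoffel _ _ _ _ hy, div_eq_mul_inv, Finset.sum_add_distrib,
      Finset.sum_sub_distrib, add_mul, sub_mul, ite_mul, mul_ite, one_mul,
      mul_one, zero_mul, mul_zero, ← norm_sq_eq_sum]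
    simp
    by_cases hij : i = j
    · subst hij; simp [← Finset.sum_mul]; ring
    · simp [hij, Ne.symm hij]; ring
  have h2 : ∑ l, ∑ m, christoffel hypMetric l l m y * christoffel hypMetric m i j y =
      n * (2 * y i * y j - (if i = j then 1 else 0) * ‖y‖ ^ 2) / conf y ^ 2 := by
    rw [Finset.sum_comm]
    simp only [← Finset.sum_mul, sum_christoffel_trace _ hy]
    simp only [christoffel_hypMetric _ _ _ hy, div_eq_mul_inv, Finset.sum_add_distrib,
      Finset.sum_sub_distrib, add_mul, sub_mul, ite_mul, mul_ite, one_mul,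
      zero_mul, mul_zero, ← norm_sq_eq_sum, mul_add, mul_sub]
    simp
    by_cases hij : i = j
    · subst hij; simp [hS']; field_simp; try ring
    · simp [hij]; field_simp; try ring
  have h3 : ∑ l, ∑ m, christoffel hypMetric l j m y * christoffel hypMetric m i l y =
      ((n + 2) * y i * y j - 2 * (if i = j then 1 else 0) * ‖y‖ ^ 2) / conf y ^ 2 := by
    simp only [christoffel_hypMetric _ _ _ hy, div_eq_mul_inv, Finset.sum_add_distrib,
      Finset.sum_sub_distrib, add_mul, sub_mul, ite_mul, mul_ite, one_mul,
      mul_one, zero_mul, mul_zero, ← norm_sq_eq_sum, mul_add, mul_sub]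
    simp [Finset.sum_add_distrib]
    by_cases hij : i = j
    · subst hij; simp [hS]; field_simp; try ring
    · simp [hij, Ne.symm hij]; field_simp; try ring
  simp only [ricci, Finset.sum_sub_distrib] at h1 ⊢
  -- The terms in y_i y_j cancel. What is left is (1-n) δ_ij (2Ω + |y|²)/Ω², and 2Ω + |y|² = 1.
  rw [h1, h2, h3, norm_sq_eq_conf]
  simp only [hypMetric, Matrix.smul_apply, Matrix.one_apply, smul_eq_mul]
  field_simp
  ring

end Metric

/-! ### The hyperboloid coordinates of the ball, and the domains `ℍⁿ_s` -/

section Chart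

variable {n : ℕ}

lemma potV_zero (y : Coord n) : potV 0 y = (1 - conf y) / conf y := by
  have h : (1 - ‖y‖ ^ 2) = 2 * conf y := by simp only [conf]; ring
  have h' : (1 + ‖y‖ ^ 2) = 2 * (1 - conf y) := by simp only [conf]; ring
  simp only [potV, Fin.cases_zero, h, h', mul_div_mul_left _ _ (two_ne_zero (α := ℝ))]

lemma potV_succ (i : Fin n) (y : Coord n) : potV i.succ y = y i / conf y := by
  have h : (1 - ‖y‖ ^ 2) = 2 * conf y := by simp only [conf]; ring
  simp only [potV, Fin.cases_succ, h, mul_div_mul_left _ _ (two_ne_zero (α := ℝ))]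

/-- The point of the ball with the given spatial hyperboloid coordinates `x_1, …, x_n`. -/
def ballPoint (x : Coord n) : Coord n := (1 + Real.sqrt (1 + ‖x‖ ^ 2))⁻¹ • x

lemma one_add_sqrt_pos (x : Coord n) : 0 < 1 + Real.sqrt (1 + ‖x‖ ^ 2) := by positivity

lemma conf_ballPoint (x : Coord n) : conf (ballPoint x) = (1 + Real.sqrt (1 + ‖x‖ ^ 2))⁻¹ := by
  have h := one_add_sqrt_pos x
  have hr : Real.sqrt (1 + ‖x‖ ^ 2) ^ 2 = 1 + ‖x‖ ^ 2 := Real.sq_sqrt (by positivity)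
  rw [conf, ballPoint, norm_smul, mul_pow, norm_inv, inv_pow, Real.norm_of_nonneg h.le]
  generalize Real.sqrt (1 + ‖x‖ ^ 2) = r at h hr
  have h2 : ‖x‖ ^ 2 = r ^ 2 - 1 := by linarith
  rw [h2]
  field_simp
  ring

lemma norm_ballPoint_lt (x : Coord n) : ‖ballPoint x‖ < 1 := by
  have h : 0 < conf (ballPoint x) := by
    rw [conf_ballPoint]; exact inv_pos.2 (one_add_sqrt_pos x)
  simp only [conf] at h
  nlinarith [norm_nonneg (ballPoint x)]

lemma potV_succ_ballPoint (i : Fin n) (x : Coord n) : potV i.succ (ballPoint x) = x i := by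
  rw [potV_succ, conf_ballPoint, ballPoint, PiLp.smul_apply, smul_eq_mul]
  have h := one_add_sqrt_pos x
  field_simp

lemma ballPoint_inv_conf_smul {y : Coord n} (hy : ‖y‖ < 1) : ballPoint ((conf y)⁻¹ • y) = y := by
  have hc := conf_pos hy
  have h1 : Real.sqrt (1 + ‖(conf y)⁻¹ • y‖ ^ 2) = (1 - conf y) / conf y := by
    rw [Real.sqrt_eq_iff_mul_self_eq_of_pos]
    · rw [norm_smul, mul_pow, norm_sq_eq_conf, Real.norm_of_nonneg (inv_nonneg.2 hc.le)]
      field_simp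
      ring
    · refine div_pos ?_ hc
      simp only [conf]
      nlinarith [norm_nonneg y]
  rw [ballPoint, h1, smul_smul]
  have : (1 + (1 - conf y) / conf y)⁻¹ * (conf y)⁻¹ = 1 := by field_simp; ring
  rw [this, one_smul]

variable {i₀ : Fin n} (h₀ : i₀.succ = 1) (s : ℝ)
include h₀

lemma mem_hypDomain {y : Coord n} : y ∈ hypDomain n s ↔ ‖y‖ < 1 ∧ y i₀ / conf y ≤ s := by
  rw [hypDomain, ← h₀, Set.mem_ofPred_eq, potV_succ]

lemma mem_hypBoundary {y : Coord n} : y ∈ hypBoundary n s ↔ ‖y‖ < 1 ∧ y i₀ / conf y = s := by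
  rw [hypBoundary, ← h₀, Set.mem_ofPred_eq, potV_succ]

/-- In the coordinates x_1, …, x_n of the hyperboloid the domain is a half-space. Convexity then
gives unique differentiability up to the boundary and the constancy of functions with zero
derivative. Here `i₀` is the index of the first coordinate. -/
lemma hypDomain_eq_image : hypDomain n s = ballPoint '' {x | x i₀ ≤ s} := by
  ext y
  constructor
  · rintro hy
    rw [mem_hypDomain h₀] at hy
    refine ⟨(conf y)⁻¹ • y, ?_, ballPoint_inv_conf_smul hy.1⟩
    simpa [div_eq_inv_mul] using hy.2
  · rintro ⟨x, hx, rfl⟩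
    refine ⟨norm_ballPoint_lt x, ?_⟩
    rw [← h₀, potV_succ_ballPoint]
    exact hx

lemma hypBoundary_nonempty : (hypBoundary n s).Nonempty := by
  refine ⟨ballPoint (s • coordVec i₀), norm_ballPoint_lt _, ?_⟩
  rw [← h₀, potV_succ_ballPoint]
  simp [coordVec]

omit h₀ in
lemma hypBoundary_subset : hypBoundary n s ⊆ hypDomain n s := fun _ h => ⟨h.1, h.2.le⟩

omit h₀ in
lemma differentiable_ballPoint : Differentiable ℝ (ballPoint : Coord n → Coord n) := by
  intro x
  have h1 : DifferentiableAt ℝ (fun x : Coord n => 1 + ‖x‖ ^ 2) x :=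
    (contDiff_norm_sq ℝ (n := 1)).differentiable (by simp) |>.differentiableAt.const_add 1
  have h2 := (h1.sqrt (by positivity)).const_add 1
  exact (h2.inv (one_add_sqrt_pos x).ne').smul differentiableAt_id

omit h₀ in
-- Near y the map z ↦ z/Ω(z) is a right inverse of `ballPoint`, so the chain rule gives a right
-- inverse of the derivative.
lemma surjective_fderiv_ballPoint (x : Coord n) :
    Function.Surjective (fderiv ℝ (ballPoint : Coord n → Coord n) x) := by
  set y := ballPoint x with hy
  have hy1 : ‖y‖ < 1 := norm_ballPoint_lt x
  have hx : (conf y)⁻¹ • y = x := by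
    rw [hy, conf_ballPoint, ballPoint, inv_inv, smul_smul,
      mul_inv_cancel₀ (one_add_sqrt_pos x).ne', one_smul]
  have hg : DifferentiableAt ℝ (fun z : Coord n => (conf z)⁻¹ • z) y :=
    ((hasFDerivAt_conf y).differentiableAt.inv (conf_pos hy1).ne').smul differentiableAt_id
  have hf : DifferentiableAt ℝ (ballPoint : Coord n → Coord n) ((conf y)⁻¹ • y) :=
    differentiable_ballPoint _
  have hcomp := fderiv_comp (f := fun z : Coord n => (conf z)⁻¹ • z) y hf hg
  have hid : (ballPoint ∘ fun z : Coord n => (conf z)⁻¹ • z) =ᶠ[nhds y] id := by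
    have : ∀ᶠ z : Coord n in nhds y, ‖z‖ < 1 :=
      (continuous_norm.tendsto y).eventually_lt_const hy1
    filter_upwards [this] with z hz
    exact ballPoint_inv_conf_smul hz
  rw [hid.fderiv_eq, fderiv_id, hx] at hcomp
  intro v
  exact ⟨_, (DFunLike.congr_fun hcomp v).symm⟩

omit h₀ in
lemma convex_halfSpace : Convex ℝ {x : Coord n | x i₀ ≤ s} :=
  convex_halfSpace_le (EuclideanSpace.proj i₀ : Coord n →L[ℝ] ℝ).isLinear s

omit h₀ in
lemma uniqueDiffOn_halfSpace : UniqueDiffOn ℝ {x : Coord n | x i₀ ≤ s} := by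
  refine uniqueDiffOn_convex (convex_halfSpace s) ⟨(s - 1) • coordVec i₀, ?_⟩
  have ho : IsOpen {x : Coord n | x i₀ < s} :=
    isOpen_lt (EuclideanSpace.proj i₀ : Coord n →L[ℝ] ℝ).continuous continuous_const
  refine interior_maximal (t := {x : Coord n | x i₀ < s}) (fun x hx => ?_) ho ?_
  · exact le_of_lt (show x i₀ < s from hx)
  simp [coordVec]

/-- This makes `fderivWithin` on ℍⁿ_s determined also at points of Σ_s, where it can then be read
off from the explicit derivatives in the ball. -/
lemma uniqueDiffOn_hypDomain : UniqueDiffOn ℝ (hypDomain n s) := by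
  rw [hypDomain_eq_image h₀]
  exact (uniqueDiffOn_halfSpace s).image
    (fun x _ => (differentiable_ballPoint x).hasFDerivAt.hasFDerivWithinAt)
    (fun x _ => (surjective_fderiv_ballPoint x).denseRange)

/-- A function on `ℍⁿ_s` with vanishing derivative is constant. -/
lemma eq_of_hasFDerivWithinAt_zero {E : Type*} [NormedAddCommGroup E] [NormedSpace ℝ E]
    {f : Coord n → E}
    (hf : ∀ y ∈ hypDomain n s, HasFDerivWithinAt f (0 : Coord n →L[ℝ] E) (hypDomain n s) y)
    {y z : Coord n} (hy : y ∈ hypDomain n s) (hz : z ∈ hypDomain n s) : f y = f z := by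
  have hm : Set.MapsTo (ballPoint : Coord n → Coord n) {x | x i₀ ≤ s} (hypDomain n s) := by
    rw [hypDomain_eq_image h₀]; exact Set.mapsTo_image _ _
  have hd : ∀ x ∈ {x : Coord n | x i₀ ≤ s},
      HasFDerivWithinAt (f ∘ ballPoint) (0 : Coord n →L[ℝ] E) {x | x i₀ ≤ s} x := fun x hx => by
    have := (hf _ (hm hx)).comp x (differentiable_ballPoint x).hasFDerivAt.hasFDerivWithinAt hm
    rwa [ContinuousLinearMap.zero_comp] at this
  rw [hypDomain_eq_image h₀] at hy hz
  obtain ⟨x, hx, rfl⟩ := hy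
  obtain ⟨w, hw, rfl⟩ := hz
  exact (convex_halfSpace s).is_const_of_fderivWithin_eq_zero (𝕜 := ℝ) (f := f ∘ ballPoint)
    (fun x hx => (hd x hx).differentiableWithinAt)
    (fun x hx => (hd x hx).fderivWithin (uniqueDiffOn_halfSpace s x hx)) hx hw

end Chart

/-! ### The static potentials -/

section Static

variable {n : ℕ}

/-- The combination `A V_(0) + ∑ B_j V_(j)`. -/
def staticFun (A : ℝ) (B : Coord n) (y : Coord n) : ℝ := (A + ⟪B, y⟫_ℝ) * (conf y)⁻¹ - A

lemma staticFun_eq_sum (A : ℝ) (B : Coord n) {y : Coord n} (hy : ‖y‖ < 1) :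
    staticFun A B y = A * potV 0 y + ∑ j, B j * potV j.succ y := by
  have := (conf_pos hy).ne'
  simp only [staticFun, potV_zero, potV_succ, inner_eq_sum, mul_div_assoc', ← Finset.sum_div]
  field_simp
  ring

lemma hasFDerivAt_staticFun (A : ℝ) (B : Coord n) {y : Coord n} (hy : conf y ≠ 0) :
    HasFDerivAt (staticFun A B)
      ((conf y)⁻¹ • innerSL ℝ B + ((A + ⟪B, y⟫_ℝ) * (conf y ^ 2)⁻¹) • innerSL ℝ y) y := by
  have h1 : HasFDerivAt (fun z : Coord n => A + ⟪B, z⟫_ℝ) (innerSL ℝ B) y :=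
    (innerSL ℝ B).hasFDerivAt.const_add A
  refine ((h1.mul (hasFDerivAt_inv_conf hy)).sub_const A).congr_fderiv ?_
  rw [smul_smul, add_comm]

lemma contDiffOn_staticFun (A : ℝ) (B : Coord n) :
    ContDiffOn ℝ ∞ (staticFun A B) {y | ‖y‖ < 1} := by
  have h1 : ContDiffOn ℝ ∞ (fun y : Coord n => (conf y)⁻¹) {y | ‖y‖ < 1} :=
    contDiff_conf.contDiffOn.inv fun y hy => (conf_pos hy).ne'
  have h2 : ContDiff ℝ ∞ (fun z : Coord n => A + ⟪B, z⟫_ℝ) :=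
    contDiff_const.add (innerSL ℝ B).contDiff
  exact (h2.contDiffOn.mul h1).sub contDiffOn_const

lemma hasFDerivAt_pderiv_staticFun (A : ℝ) (B : Coord n) (j : Fin n) {y : Coord n}
    (hy : conf y ≠ 0) :
    HasFDerivAt (fun z : Coord n => (conf z)⁻¹ * B j + (A + ⟪B, z⟫_ℝ) * (conf z)⁻¹ ^ 2 * z j)
      (B j • ((conf y ^ 2)⁻¹ • innerSL ℝ y) + (((A + ⟪B, y⟫_ℝ) * (conf y)⁻¹ ^ 2) •
        (EuclideanSpace.proj j : Coord n →L[ℝ] ℝ) + y j • ((A + ⟪B, y⟫_ℝ) •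
          ((2 * (conf y)⁻¹) • ((conf y ^ 2)⁻¹ • innerSL ℝ y))
            + (conf y)⁻¹ ^ 2 • innerSL ℝ B))) y := by
  have h1 : HasFDerivAt (fun z : Coord n => A + ⟪B, z⟫_ℝ) (innerSL ℝ B) y :=
    (innerSL ℝ B).hasFDerivAt.const_add A
  have h2 := (hasFDerivAt_inv_conf hy).mul_const (B j)
  have h3 : HasFDerivAt (fun z : Coord n => (conf z)⁻¹ ^ 2)
      ((2 * (conf y)⁻¹) • ((conf y ^ 2)⁻¹ • innerSL ℝ y)) y :=
    ((hasFDerivAt_inv_conf hy).pow 2).congr_fderiv (by simp)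
  exact h2.add ((h1.mul h3).mul (hasFDerivAt_coord j y))

variable {i₀ : Fin n} (h₀ : i₀.succ = 1) (s : ℝ)
include h₀

lemma pderivOn_staticFun (A : ℝ) (B : Coord n) (j : Fin n) {y : Coord n}
    (hy : y ∈ hypDomain n s) : pderivOn (hypDomain n s) (staticFun A B) j y =
      (conf y)⁻¹ * B j + (A + ⟪B, y⟫_ℝ) * (conf y)⁻¹ ^ 2 * y j := by
  rw [pderivOn, (hasFDerivAt_staticFun A B (conf_pos hy.1).ne').hasFDerivWithinAt.fderivWithin
    (uniqueDiffOn_hypDomain h₀ s y hy)]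
  simp [inner_coordVec]

omit h₀ in
lemma sum_christoffel_mul (i j : Fin n) (v : Fin n → ℝ) {y : Coord n} (hy : conf y ≠ 0) :
    ∑ l, christoffel hypMetric l i j y * v l =
      (y i * v j + y j * v i - (if i = j then 1 else 0) * ∑ l, y l * v l) / conf y := by
  simp only [christoffel_hypMetric _ _ _ hy, div_mul_eq_mul_div, ← Finset.sum_div]
  congr 1
  simp only [sub_mul, add_mul, Finset.sum_add_distrib, Finset.sum_sub_distrib, ite_mul, one_mul, zero_mul, Finset.sum_ite_eq', Finset.mem_univ, if_true]
  split_ifs <;> simp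

/-- The linear coordinates of Minkowski space satisfy ∇²V = V b on the hyperboloid. Tracing gives ΔV
= nV, and with Ric = -(n-1) b the tensor equation follows as well. -/
lemma hessianOn_staticFun (A : ℝ) (B : Coord n) (i j : Fin n) {y : Coord n}
    (hy : y ∈ hypDomain n s) : hessianOn (hypDomain n s) hypMetric (staticFun A B) i j y =
      staticFun A B y * hypMetric y i j := by
  have hc := (conf_pos hy.1).ne'
  have h1 : pderivOn (hypDomain n s) (pderivOn (hypDomain n s) (staticFun A B) j) i y =
      (B j * y i + B i * y j) / conf y ^ 2 + (A + ⟪B, y⟫_ℝ) *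
        ((if j = i then 1 else 0) / conf y ^ 2 + 2 * y i * y j / conf y ^ 3) := by
    -- The formula for the first derivatives holds only on the domain, so it is substituted under
    -- the derivative within that set.
    rw [pderivOn, fderivWithin_congr (fun z hz => pderivOn_staticFun h₀ s A B j hz)
      (pderivOn_staticFun h₀ s A B j hy),
      (hasFDerivAt_pderiv_staticFun A B j hc).hasFDerivWithinAt.fderivWithin
      (uniqueDiffOn_hypDomain h₀ s y hy)]
    simp only [smul_apply, add_apply, innerSL_apply_apply, inner_coordVec, proj_coordVec,
      smul_eq_mul]
    field_simp
    ring
  have h2 : ∑ l, y l * pderivOn (hypDomain n s) (staticFun A B) l y =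
      (conf y)⁻¹ * ⟪B, y⟫_ℝ + (A + ⟪B, y⟫_ℝ) * (conf y)⁻¹ ^ 2 * ‖y‖ ^ 2 := by
    simp only [pderivOn_staticFun h₀ s A B _ hy]
    rw [← norm_sq_eq_sum, real_inner_comm, inner_eq_sum, Finset.mul_sum, Finset.mul_sum,
      ← Finset.sum_add_distrib]
    exact Finset.sum_congr rfl fun l _ => by ring
  rw [hessianOn, h1, sum_christoffel_mul _ _ _ hc, h2, pderivOn_staticFun h₀ s A B _ hy,
    pderivOn_staticFun h₀ s A B _ hy, norm_sq_eq_conf]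
  simp only [staticFun, hypMetric, Matrix.smul_apply, Matrix.one_apply, smul_eq_mul,
    eq_comm (a := j) (b := i)]
  field_simp
  ring

omit h₀ in
lemma sum_smul_coordVec_apply (c : Fin n → ℝ) (j : Fin n) :
    (∑ i, c i • (coordVec i : Coord n)) j = c j := by
  simp [coordVec_apply]

omit h₀ in
lemma gradient_hypMetric_potV_succ (i : Fin n) {y : Coord n} (hy : conf y ≠ 0) :
    gradient hypMetric (potV i.succ) y = conf y • coordVec i + y i • y := by
  have h : HasFDerivAt (potV i.succ : Coord n → ℝ) (y i • ((conf y ^ 2)⁻¹ • innerSL ℝ y) +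
      (conf y)⁻¹ • (EuclideanSpace.proj i : Coord n →L[ℝ] ℝ)) y := by
    have := (hasFDerivAt_coord i y).mul (hasFDerivAt_inv_conf hy)
    refine this.congr_of_eventuallyEq (Filter.Eventually.of_forall fun z => ?_)
    simp [potV_succ, div_eq_mul_inv]
  ext j
  simp only [gradient, hypMetric_inv hy, pderiv, h.fderiv]
  rw [sum_smul_coordVec_apply]
  simp only [Matrix.smul_apply, Matrix.one_apply, smul_eq_mul, mul_ite, mul_one, mul_zero, ite_mul,
    zero_mul, Finset.sum_ite_eq, Finset.mem_univ, if_true, smul_apply, add_apply,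
    innerSL_apply_apply, inner_coordVec, proj_coordVec, PiLp.add_apply, PiLp.smul_apply,
    coordVec_apply, eq_comm (a := j) (b := i)]
  split_ifs <;> field_simp <;> ring

/-- The normalising factor comes from |∇V_(1)|² = 1 + V_(1)², which is 1 + s² along Σ_s. -/
lemma outNormal_eq {y : Coord n} (hy : y ∈ hypBoundary n s) :
    outNormal y = (Real.sqrt (1 + s ^ 2))⁻¹ • (conf y • coordVec i₀ + y i₀ • y) := by
  have hc := (conf_pos hy.1).ne'
  rw [mem_hypBoundary h₀] at hy
  rw [outNormal, ← h₀, gradient_hypMetric_potV_succ _ hc, metricVal_hypMetric]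
  congr 3
  rw [← hy.2]
  simp only [inner_add_left, inner_add_right, real_inner_smul_left, real_inner_smul_right,
    inner_coordVec, real_inner_comm y (coordVec i₀), coordVec_apply, if_true]
  rw [real_inner_self_eq_norm_sq, norm_sq_eq_conf]
  field_simp
  ring

lemma solvesStatic_staticFun (A : ℝ) {B : Coord n} (hB : B i₀ = 0) :
    SolvesStatic n s (staticFun A B) where
  smooth := (contDiffOn_staticFun A B).mono fun _ hy => hy.1
  hessian_eq y hy i j := by
    rw [hessianOn_staticFun h₀ s A B i j hy, ricci_hypMetric i j (conf_pos hy.1).ne']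
    ring
  laplacian_eq y hy := by
    have hc := (conf_pos hy.1).ne'
    simp only [laplacianOn, hessianOn_staticFun h₀ s A B _ _ hy, hypMetric_inv hc]
    simp only [hypMetric,
      Matrix.smul_apply, Matrix.one_apply, smul_eq_mul, mul_ite, mul_one, mul_zero,
      Finset.sum_ite_eq, Finset.mem_univ, if_true, Finset.sum_const, Finset.card_univ,
      Fintype.card_fin, nsmul_eq_mul]
    field_simp
    ring
  boundary_eq y hy := by
    have hc := (conf_pos hy.1).ne'
    rw [(hasFDerivAt_staticFun A B hc).hasFDerivWithinAt.fderivWithin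
      (uniqueDiffOn_hypDomain h₀ s y (hypBoundary_subset s hy)), outNormal_eq h₀ s hy]
    rw [mem_hypBoundary h₀] at hy
    -- On Σ_s this gives b-derivative λ_s V along the normal, apart from a term proportional to B_1,
    -- which vanishes by `hB`.
    have hy2 : y i₀ = s * conf y := by rw [← hy.2]; field_simp
    simp only [smul_apply, add_apply, innerSL_apply_apply, map_smul, map_add, inner_coordVec, hB,
      smul_eq_mul, real_inner_self_eq_norm_sq,
      norm_sq_eq_conf, umbilicity, staticFun, hy2]
    field_simp
    ring

omit h₀ in
/-- The static equations only depend on the values on `ℍⁿ_s`. -/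
lemma SolvesStatic.congr {V W : Coord n → ℝ} (hV : SolvesStatic n s V)
    (h : Set.EqOn W V (hypDomain n s)) : SolvesStatic n s W := by
  have hp : ∀ j, Set.EqOn (pderivOn (hypDomain n s) W j) (pderivOn (hypDomain n s) V j)
      (hypDomain n s) := fun j y hy => by
    rw [pderivOn, pderivOn, fderivWithin_congr h (h hy)]
  have hh : ∀ i j, ∀ y ∈ hypDomain n s, hessianOn (hypDomain n s) hypMetric W i j y =
      hessianOn (hypDomain n s) hypMetric V i j y := fun i j y hy => by
    simp only [hessianOn]
    congr 1
    · rw [pderivOn, pderivOn, fderivWithin_congr (hp j) (hp j hy)]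
    · exact Finset.sum_congr rfl fun l _ => by rw [hp l hy]
  refine ⟨hV.smooth.congr h, fun y hy i j => ?_, fun y hy => ?_, fun y hy => ?_⟩
  · rw [hh i j y hy, h hy]; exact hV.hessian_eq y hy i j
  · simp only [laplacianOn, hh _ _ y hy, h hy]; exact hV.laplacian_eq y hy
  · have hy' := hypBoundary_subset s hy
    rw [fderivWithin_congr h (h hy'), h hy']; exact hV.boundary_eq y hy

end Static

/-! ### The spin connection of the ball -/

section SpinConnection

variable {k : ℕ}

lemma covDeriv_hypFrame (X : Coord (2 * k)) (a : Fin (2 * k)) {y : Coord (2 * k)}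
    (hy : conf y ≠ 0) : covDeriv hypMetric X (hypFrame a) y = y a • X - X a • y := by
  have h1 : HasFDerivAt (hypFrame a : Coord (2 * k) → Coord (2 * k))
      ((-(innerSL ℝ y)).smulRight (coordVec a)) y :=
    (hasFDerivAt_conf y).smul_const (coordVec a)
  ext m
  rw [covDeriv, h1.fderiv, PiLp.add_apply, sum_smul_coordVec_apply]
  have h2 : ∑ i, ∑ j, christoffel hypMetric m i j y * X i * hypFrame a y j =
      (if m = a then 1 else 0) * ⟪y, X⟫_ℝ + X m * y a - X a * y m := by
    have h3 : ∀ i, ∑ j, christoffel hypMetric m i j y * X i * hypFrame a y j =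
        (if m = a then 1 else 0) * (y i * X i) + (if m = i then X i else 0) * y a
          - (if i = a then X i else 0) * y m := by
      intro i
      rw [Finset.sum_eq_single a]
      · rw [christoffel_hypMetric _ _ _ hy, hypFrame, PiLp.smul_apply, coordVec_apply, if_pos rfl]
        split_ifs <;> simp <;> field_simp
      · intro j _ hj
        rw [hypFrame, PiLp.smul_apply, coordVec_apply, if_neg hj]; simp
      · simp
    simp only [h3, Finset.sum_add_distrib, Finset.sum_sub_distrib, ← Finset.sum_mul,
      ← Finset.mul_sum, inner_eq_sum]
    simp
  rw [h2]
  simp only [ContinuousLinearMap.smulRight_apply, neg_apply, innerSL_apply_apply, PiLp.smul_apply,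
    coordVec_apply, smul_eq_mul, PiLp.sub_apply]
  ring

lemma cliff_apply {y : Coord (2 * k)} (X : Coord (2 * k)) (hy : conf y ≠ 0) (x : Spinor k) :
    cliff y X x = (((conf y)⁻¹ : ℝ) : ℂ) • gam k X x := by
  rw [cliff, sum_apply, gam_apply, Finset.smul_sum]
  refine Finset.sum_congr rfl fun a _ => ?_
  rw [smul_apply, smul_smul, metricVal_hypMetric, hypFrame, real_inner_smul_right,
    inner_coordVec, ← Complex.ofReal_mul]
  congr 2
  field_simp

lemma cliff_hypFrame {y : Coord (2 * k)} (a : Fin (2 * k)) (hy : conf y ≠ 0) (x : Spinor k) :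
    cliff y (hypFrame a y) x = gamma k a x := by
  rw [cliff_apply _ hy, hypFrame, gam_smul, gam_coordVec, smul_smul, ← Complex.ofReal_mul,
    inv_mul_cancel₀ hy, Complex.ofReal_one, one_smul]

/-- The connection form is b(∇_X e_a, e_b) = Ω⁻¹(y_a X_b - X_a y_b), so the double sum collapses to
a commutator of c(y) and c(X). -/
lemma spinDeriv_eq (s : ℝ) (Φ : Coord (2 * k) → Spinor k) (X : Coord (2 * k))
    {y : Coord (2 * k)} (hy : conf y ≠ 0) :
    spinDeriv s Φ X y = fderivWithin ℝ Φ (hypDomain (2 * k) s) y X +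
      (((conf y)⁻¹ / 4 : ℝ) : ℂ) • (gam k y (gam k X (Φ y)) - gam k X (gam k y (Φ y))) := by
  rw [spinDeriv]
  congr 1
  have h : ∀ a b, metricVal hypMetric y (covDeriv hypMetric X (hypFrame a) y) (hypFrame b y) =
      (conf y)⁻¹ * (y a * X b - X a * y b) := by
    intro a b
    rw [covDeriv_hypFrame X a hy, metricVal_hypMetric, hypFrame, real_inner_smul_right,
      inner_coordVec]
    simp only [PiLp.sub_apply, PiLp.smul_apply, smul_eq_mul]
    field_simp
  simp only [h, gam_apply, map_sum, map_smul, Finset.smul_sum, ← Finset.sum_sub_distrib,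
    smul_smul, ← sub_smul]
  rw [Finset.sum_comm]
  refine Finset.sum_congr rfl fun a _ => Finset.sum_congr rfl fun b _ => ?_
  congr 1
  push_cast
  ring

end SpinConnection

/-! ### Imaginary Killing spinors -/

section Killing

variable {k : ℕ}

/-- The imaginary Killing spinor `Ω^{-1/2} (1 - J c(y)) u` with respect to the constant `J = ± i`,
where `c` is the Euclidean Clifford multiplication. -/
def killingSpinor (J : ℂ) (u : Spinor k) (y : Coord (2 * k)) : Spinor k :=
  (Real.sqrt (conf y))⁻¹ • (u - J • gam k y u)

lemma hasFDerivAt_inv_sqrt_conf {y : Coord (2 * k)} (hy : 0 < conf y) :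
    HasFDerivAt (fun z : Coord (2 * k) => (Real.sqrt (conf z))⁻¹)
      (((Real.sqrt (conf y))⁻¹ * ((conf y)⁻¹ / 2)) • innerSL ℝ y) y := by
  have h1 := (hasFDerivAt_conf y).sqrt hy.ne'
  have hs := Real.sqrt_pos.2 hy
  refine ((hasDerivAt_inv hs.ne').comp_hasFDerivAt y h1).congr_fderiv ?_
  ext v
  simp only [smul_apply, neg_apply, smul_eq_mul]
  have : conf y = Real.sqrt (conf y) * Real.sqrt (conf y) := (Real.mul_self_sqrt hy.le).symm
  generalize Real.sqrt (conf y) = r at *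
  rw [this]
  field_simp

/-- The product rule for Clifford multiplication by the position vector. -/
lemma hasFDerivWithinAt_gam {Φ : Coord (2 * k) → Spinor k} {S : Set (Coord (2 * k))}
    {y : Coord (2 * k)} {Φ' : Coord (2 * k) →L[ℝ] Spinor k} (hΦ : HasFDerivWithinAt Φ Φ' S y) :
    ∃ L : Coord (2 * k) →L[ℝ] Spinor k, HasFDerivWithinAt (fun z => gam k z (Φ z)) L S y ∧
      ∀ X, L X = gam k X (Φ y) + gam k y (Φ' X) := by
  have h1 : ∀ a : Fin (2 * k), HasFDerivWithinAt
      (fun z : Coord (2 * k) => z a • gamma k a (Φ z))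
      (y a • ((gamma k a).restrictScalars ℝ ∘L Φ') +
        (EuclideanSpace.proj a : Coord (2 * k) →L[ℝ] ℝ).smulRight (gamma k a (Φ y))) S y :=
    fun a => (hasFDerivAt_coord a y).hasFDerivWithinAt.smul
      (((gamma k a).restrictScalars ℝ).hasFDerivAt.comp_hasFDerivWithinAt y hΦ)
  have h2 := HasFDerivWithinAt.fun_sum (u := Finset.univ) fun a _ => h1 a
  refine ⟨_, h2.congr (fun z _ => ?_) ?_, fun X => ?_⟩
  · simp only [gam_apply, Complex.coe_smul]
  · simp only [gam_apply, Complex.coe_smul]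
  · simp only [sum_apply, add_apply, smul_apply, ContinuousLinearMap.comp_apply,
      ContinuousLinearMap.coe_restrictScalars', ContinuousLinearMap.smulRight_apply, gam_apply,
      Finset.sum_add_distrib, Complex.coe_smul]
    rw [add_comm]
    rfl

lemma contDiff_gam (u : Spinor k) : ContDiff ℝ ∞ (fun y => gam k y u) := by
  simp only [gam_apply, Complex.coe_smul]
  refine ContDiff.sum fun a _ => ?_
  exact (EuclideanSpace.proj a : Coord (2 * k) →L[ℝ] ℝ).contDiff.smul contDiff_const

lemma contDiffOn_killingSpinor (J : ℂ) (u : Spinor k) :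
    ContDiffOn ℝ ∞ (killingSpinor J u) {y | ‖y‖ < 1} := by
  have h1 : ContDiffOn ℝ ∞ (fun y : Coord (2 * k) => (Real.sqrt (conf y))⁻¹) {y | ‖y‖ < 1} :=
    (contDiff_conf.contDiffOn.sqrt fun y hy => (conf_pos hy).ne').inv
      fun y hy => (Real.sqrt_pos.2 (conf_pos hy)).ne'
  refine h1.smul (contDiff_const.sub ?_).contDiffOn
  exact (contDiff_gam u).const_smul J

lemma gam_gam_comm (y X : Coord (2 * k)) (x : Spinor k) :
    gam k X (gam k y x) = -gam k y (gam k X x) + ((-2 * ⟪y, X⟫_ℝ : ℝ) : ℂ) • x := by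
  rw [← gam_gam_add y X x]; abel

/-- Once every c(X)c(y) is rewritten through c(y)c(X), the terms cancel using only J² = -1, c(y)² =
-|y|² = 2Ω - 1 and Ω⁻¹Ω = 1. -/
lemma killingSpinor_killing {J : ℂ} (hJ : J * J = -1) (u : Spinor k) {i₀ : Fin (2 * k)}
    (h₀ : i₀.succ = 1) (s : ℝ) {y : Coord (2 * k)} (hy : y ∈ hypDomain (2 * k) s)
    (X : Coord (2 * k)) :
    spinDeriv s (killingSpinor J u) X y + (J / 2) • cliff y X (killingSpinor J u y) = 0 := by
  have hc := conf_pos hy.1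
  obtain ⟨L, hL, hLX⟩ := hasFDerivWithinAt_gam (hasFDerivWithinAt_const u y (hypDomain (2 * k) s))
  have h1 := (hasFDerivAt_inv_sqrt_conf hc).hasFDerivWithinAt.smul
    ((hasFDerivWithinAt_const u y (hypDomain (2 * k) s)).sub (hL.const_smul J))
  have h2 : fderivWithin ℝ (killingSpinor J u) (hypDomain (2 * k) s) y X =
      (Real.sqrt (conf y))⁻¹ • (-(J • gam k X u)) +
      ((Real.sqrt (conf y))⁻¹ * ((conf y)⁻¹ / 2) * ⟪y, X⟫_ℝ) • (u - J • gam k y u) := by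
    refine (DFunLike.congr_fun (h1.fderivWithin (uniqueDiffOn_hypDomain h₀ s y hy)) X).trans ?_
    simp [hLX]
  rw [spinDeriv_eq _ _ _ hc.ne', cliff_apply _ hc.ne', h2]
  have hw : (((conf y)⁻¹ : ℝ) : ℂ) * ((conf y : ℝ) : ℂ) = 1 := by
    rw [← Complex.ofReal_mul, inv_mul_cancel₀ hc.ne', Complex.ofReal_one]
  simp only [killingSpinor, ← Complex.coe_smul, map_smul, map_sub, map_add, map_neg,
    gam_gam_comm y X, gam_gam_self, norm_sq_eq_conf, Complex.ofReal_mul, Complex.ofReal_sub,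
    Complex.ofReal_div, Complex.ofReal_one, Complex.ofReal_ofNat, Complex.ofReal_neg]
  generalize (((Real.sqrt (conf y))⁻¹ : ℝ) : ℂ) = ρ
  generalize (((conf y)⁻¹ : ℝ) : ℂ) = w at *
  linear_combination (norm := module) hJ • ((ρ * w * ((⟪y, X⟫_ℝ : ℝ) : ℂ)) • u) +
    hJ • ((ρ * w / 2) • gam k y (gam k X u)) + hw • ((ρ * J) • gam k X u)

/-- Every imaginary Killing spinor is one of the `killingSpinor J u`. -/
lemma exists_eq_killingSpinor {J : ℂ} (hJ : J * J = -1) {i₀ : Fin (2 * k)}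
    (h₀ : i₀.succ = 1) {s : ℝ} {Φ : Coord (2 * k) → Spinor k}
    (hs : ContDiffOn ℝ ∞ Φ (hypDomain (2 * k) s))
    (hΦ : ∀ y ∈ hypDomain (2 * k) s, ∀ X : Coord (2 * k),
      spinDeriv s Φ X y + (J / 2) • cliff y X (Φ y) = 0) :
    ∃ u, Set.EqOn Φ (killingSpinor J u) (hypDomain (2 * k) s) := by
  -- As (1 - J c(y))(1 + J c(y)) = 2Ω, this undoes the construction of `killingSpinor` up to a
  -- factor 2. It is therefore the candidate for a constant.
  set U : Coord (2 * k) → Spinor k :=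
    fun z => (Real.sqrt (conf z))⁻¹ • (Φ z + J • gam k z (Φ z)) with hU
  have hd : ∀ y ∈ hypDomain (2 * k) s,
      HasFDerivWithinAt U (0 : Coord (2 * k) →L[ℝ] Spinor k) (hypDomain (2 * k) s) y := by
    intro y hy
    have hc := conf_pos hy.1
    have hΦd := ((hs.differentiableOn (by simp)) y hy).hasFDerivWithinAt
    obtain ⟨L, hL, hLX⟩ := hasFDerivWithinAt_gam hΦd
    have h1 := (hasFDerivAt_inv_sqrt_conf hc).hasFDerivWithinAt.smul (hΦd.add (hL.const_smul J))
    refine h1.congr_fderiv ?_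
    ext1 X
    have h2 := hΦ y hy X
    rw [spinDeriv_eq _ _ _ hc.ne', cliff_apply _ hc.ne'] at h2
    -- The derivative of U contains J c(y) applied to that of Φ, so the Killing equation is also
    -- needed after multiplication by c(y).
    have h3 := congrArg (gam k y) h2
    have hw : (((conf y)⁻¹ : ℝ) : ℂ) * ((conf y : ℝ) : ℂ) = 1 := by
      rw [← Complex.ofReal_mul, inv_mul_cancel₀ hc.ne', Complex.ofReal_one]
    simp only [ContinuousLinearMap.smulRight_apply, add_apply, smul_apply, innerSL_apply_apply,
      Pi.add_apply, Pi.smul_apply, hLX, zero_apply, smul_eq_mul]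
    simp only [← Complex.coe_smul, map_smul, map_sub, map_add, map_neg, map_zero,
      gam_gam_comm y X, gam_gam_self, norm_sq_eq_conf, Complex.ofReal_mul, Complex.ofReal_sub,
      Complex.ofReal_div, Complex.ofReal_one, Complex.ofReal_ofNat, Complex.ofReal_neg] at h2 h3 ⊢
    generalize (((Real.sqrt (conf y))⁻¹ : ℝ) : ℂ) = ρ
    generalize (((conf y)⁻¹ : ℝ) : ℂ) = w at *
    linear_combination (norm := module) ρ • h2 + (ρ * J) • h3 - hw • ((ρ * J) • gam k X (Φ y)) -
      hJ • ((ρ * w / 2) • gam k y (gam k X (Φ y)))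
  obtain ⟨p, hp⟩ := hypBoundary_nonempty h₀ s
  -- The factor 1/2 compensates the 2 in (1 - J c(y))(1 + J c(y)) = 2Ω.
  refine ⟨(1 / 2 : ℂ) • U p, fun y hy => ?_⟩
  rw [eq_of_hasFDerivWithinAt_zero h₀ s hd (hypBoundary_subset s hp) hy]
  have hc := conf_pos hy.1
  have hw : (((Real.sqrt (conf y))⁻¹ : ℝ) : ℂ) * (((Real.sqrt (conf y))⁻¹ : ℝ) : ℂ) *
      ((conf y : ℝ) : ℂ) = 1 := by
    rw [← Complex.ofReal_mul, ← Complex.ofReal_mul, ← mul_inv, Real.mul_self_sqrt hc.le,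
      inv_mul_cancel₀ hc.ne', Complex.ofReal_one]
  simp only [killingSpinor, hU]
  simp only [← Complex.coe_smul, map_smul, map_add, gam_gam_self, norm_sq_eq_conf,
    Complex.ofReal_mul, Complex.ofReal_sub, Complex.ofReal_one, Complex.ofReal_ofNat]
  generalize (((Real.sqrt (conf y))⁻¹ : ℝ) : ℂ) = ρ at *
  linear_combination (norm := module) -(hw • Φ y) -
    hJ • ((ρ * ρ / 2 * (1 - 2 * ((conf y : ℝ) : ℂ))) • Φ y)

end Killing

/-! ### The boundary condition -/

section Boundary

variable {k : ℕ}

/-- On Σ_s one has y_1 = sΩ, so -ν = Ω(cos θ ∂_1 + sin θ y), while e^{iθQ} Q = cos θ Q + i sin θ. -/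
lemma thetaOp_apply {i₀ : Fin (2 * k)} (h₀ : i₀.succ = 1) {θ s : ℝ} {y : Coord (2 * k)}
    (hy : y ∈ hypBoundary (2 * k) s) (hc : Real.cos θ = (Real.sqrt (1 + s ^ 2))⁻¹)
    (hs : Real.sin θ = s * Real.cos θ) (x : Spinor k) :
    thetaOp θ y x =
      -((Real.cos θ : ℂ) • chirality k ((Real.cos θ : ℂ) • gamma k i₀ x +
          (Real.sin θ : ℂ) • gam k y x) +
        (Complex.I * (Real.sin θ : ℂ)) • ((Real.cos θ : ℂ) • gamma k i₀ x +
          (Real.sin θ : ℂ) • gam k y x)) := by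
  have hcf := (conf_pos hy.1).ne'
  have h1 : cliff y (-outNormal y) x =
      -((Real.cos θ : ℂ) • gamma k i₀ x + (Real.sin θ : ℂ) • gam k y x) := by
    have e : -outNormal y = (-(Real.cos θ * conf y)) • coordVec i₀ +
        (-(Real.sin θ * conf y)) • y := by
      rw [outNormal_eq h₀ s hy, ← hc, hs]
      rw [mem_hypBoundary h₀] at hy
      have : y i₀ = s * conf y := by rw [← hy.2]; field_simp
      rw [this]
      module
    rw [cliff_apply _ hcf, e, gam_add, gam_smul, gam_smul, gam_coordVec]
    have hw : (((conf y)⁻¹ : ℝ) : ℂ) * ((conf y : ℝ) : ℂ) = 1 := by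
      rw [← Complex.ofReal_mul, inv_mul_cancel₀ hcf, Complex.ofReal_one]
    simp only [Complex.ofReal_neg, Complex.ofReal_mul]
    linear_combination (norm := module) hw • (-((Real.cos θ : ℂ) • gamma k i₀ x) -
      (Real.sin θ : ℂ) • gam k y x)
  have h2 : thetaOp θ y x = NormedSpace.exp ((Complex.I * (θ : ℂ)) • chirality k)
    (chirality k (cliff y (-outNormal y) x)) := rfl
  rw [h2, exp_chirality_apply, h1, chirality_chirality, map_neg]
  module

lemma units_mul_self_complex (ε : ℤˣ) : (((ε : ℤ) : ℂ)) * ((ε : ℤ) : ℂ) = 1 := by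
  rw [← Int.cast_mul, Int.units_coe_mul_self, Int.cast_one]

lemma imaginary_mul_self (ε : ℤˣ) :
    (((ε : ℤ) : ℂ) * Complex.I) * (((ε : ℤ) : ℂ) * Complex.I) = -1 := by
  rw [mul_mul_mul_comm, units_mul_self_complex, Complex.I_mul_I, one_mul]

/-- The defect factors as a nonzero scalar times (cos θ Q + i sin θ)(1 + J c(y)) applied to Qu +
εγ_1 u. Both operators are invertible in the ball, so only the last vector matters. -/
lemma thetaOp_killingSpinor_sub {i₀ : Fin (2 * k)} (h₀ : i₀.succ = 1) {θ s : ℝ}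
    {y : Coord (2 * k)} (hy : y ∈ hypBoundary (2 * k) s)
    (hc : Real.cos θ = (Real.sqrt (1 + s ^ 2))⁻¹) (hs : Real.sin θ = s * Real.cos θ)
    (ε : ℤˣ) (u : Spinor k) :
    thetaOp θ y (killingSpinor (((ε : ℤ) : ℂ) * Complex.I) u y) -
        ((ε : ℤ) : ℂ) • killingSpinor (((ε : ℤ) : ℂ) * Complex.I) u y =
      -((((Real.sqrt (conf y))⁻¹ : ℝ) : ℂ) * ((ε : ℤ) : ℂ) * (Real.cos θ : ℂ)) •
        ((Real.cos θ : ℂ) • chirality k ((chirality k u + ((ε : ℤ) : ℂ) • gamma k i₀ u) +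
          (((ε : ℤ) : ℂ) * Complex.I) • gam k y (chirality k u + ((ε : ℤ) : ℂ) • gamma k i₀ u)) +
        (Complex.I * (Real.sin θ : ℂ)) • ((chirality k u + ((ε : ℤ) : ℂ) • gamma k i₀ u) +
          (((ε : ℤ) : ℂ) * Complex.I) • gam k y (chirality k u + ((ε : ℤ) : ℂ) • gamma k i₀ u))) := by
  rw [thetaOp_apply h₀ hy hc hs]
  have hcf := (conf_pos hy.1).ne'
  rw [mem_hypBoundary h₀] at hy
  have hy2 : Real.cos θ * y i₀ = Real.sin θ * conf y := by rw [hs, ← hy.2]; field_simp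
  have hy3 : (Real.cos θ : ℂ) * ((y i₀ : ℝ) : ℂ) = (Real.sin θ : ℂ) * ((conf y : ℝ) : ℂ) := by
    exact_mod_cast hy2
  have hcs : (Real.sin θ : ℂ) ^ 2 + (Real.cos θ : ℂ) ^ 2 = 1 := by
    exact_mod_cast Real.sin_sq_add_cos_sq θ
  have hε := units_mul_self_complex ε
  have hJ := imaginary_mul_self ε
  -- With i written as Jε, the constants J and ε can be treated as independent symbols subject to J²
  -- = -1 and ε² = 1.
  have hI : Complex.I = (((ε : ℤ) : ℂ) * Complex.I) * ((ε : ℤ) : ℂ) := by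
    rw [mul_right_comm, hε, one_mul]
  have hcomm : gamma k i₀ (gam k y u) = -gam k y (gamma k i₀ u) +
      ((-2 * y i₀ : ℝ) : ℂ) • u := by
    have := gam_gam_comm y (coordVec i₀) u
    rwa [gam_coordVec, gam_coordVec, inner_coordVec] at this
  -- Moving the normal past 1 - J c(y) turns it into 1 + J c(y) on the ∂_1 part; the scalar left
  -- over is controlled by cos θ · y_1 = sin θ · Ω.
  have hW : (Real.cos θ : ℂ) • gamma k i₀ (u - (((ε : ℤ) : ℂ) * Complex.I) • gam k y u) +
        (Real.sin θ : ℂ) • gam k y (u - (((ε : ℤ) : ℂ) * Complex.I) • gam k y u) =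
      (Real.cos θ : ℂ) • (gamma k i₀ u + (((ε : ℤ) : ℂ) * Complex.I) • gam k y (gamma k i₀ u)) +
        ((((ε : ℤ) : ℂ) * Complex.I) * (Real.sin θ : ℂ)) •
          (u - (((ε : ℤ) : ℂ) * Complex.I) • gam k y u) := by
    simp only [map_sub, map_smul, hcomm, gam_gam_self, norm_sq_eq_conf, Complex.ofReal_mul,
      Complex.ofReal_sub, Complex.ofReal_one, Complex.ofReal_ofNat, Complex.ofReal_neg]
    generalize ((ε : ℤ) : ℂ) * Complex.I = J at *
    linear_combination (norm := module) hy3 • ((2 * J) • u) +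
      hJ • ((Real.sin θ : ℂ) • gam k y u)
  have hW' : ∀ ρ : ℂ, (Real.cos θ : ℂ) •
        gamma k i₀ (ρ • (u - (((ε : ℤ) : ℂ) * Complex.I) • gam k y u)) +
      (Real.sin θ : ℂ) • gam k y (ρ • (u - (((ε : ℤ) : ℂ) * Complex.I) • gam k y u)) =
      ρ • ((Real.cos θ : ℂ) •
        (gamma k i₀ u + (((ε : ℤ) : ℂ) * Complex.I) • gam k y (gamma k i₀ u)) +
        ((((ε : ℤ) : ℂ) * Complex.I) * (Real.sin θ : ℂ)) •
          (u - (((ε : ℤ) : ℂ) * Complex.I) • gam k y u)) := fun ρ => by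
    rw [← hW, map_smul, map_smul]; module
  simp only [killingSpinor]
  simp only [← Complex.coe_smul]
  rw [hW']
  generalize ((ε : ℤ) : ℂ) * Complex.I = J at *
  rw [hI]
  simp only [map_smul, map_add, map_sub, chirality_gam, chirality_gamma, chirality_chirality,
    map_neg]
  generalize (((Real.sqrt (conf y))⁻¹ : ℝ) : ℂ) = ρ
  generalize ((ε : ℤ) : ℂ) = e at *
  generalize ((Real.cos θ : ℝ) : ℂ) = c at *
  generalize ((Real.sin θ : ℝ) : ℂ) = σ at *
  linear_combination (norm := module) hε • (ρ • (-(c ^ 2) • gamma k i₀ (chirality k u) +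
      (c ^ 2 * J) • gam k y (gamma k i₀ (chirality k u)) + (c * J * σ) • chirality k u +
      (c * J ^ 2 * σ) • gam k y (chirality k u) + (J * e * σ * c) • gamma k i₀ u +
      (J ^ 2 * e * σ * c) • gam k y (gamma k i₀ u))) +
    hJ • (ρ • (-(e * σ ^ 2) • u + (e * σ ^ 2 * J) • gam k y u)) +
    hcs • (ρ • (e • u - (e * J) • gam k y u))

end Boundary

section Density

variable {k : ℕ}

/-- Since the right-hand side does not involve y, the boundary condition at a single point of Σ_s
implies it at all of them. -/
lemma thetaOp_killingSpinor_iff {i₀ : Fin (2 * k)} (h₀ : i₀.succ = 1) {θ s : ℝ}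
    {y : Coord (2 * k)} (hy : y ∈ hypBoundary (2 * k) s)
    (hc : Real.cos θ = (Real.sqrt (1 + s ^ 2))⁻¹) (hs : Real.sin θ = s * Real.cos θ)
    (ε : ℤˣ) (u : Spinor k) :
    thetaOp θ y (killingSpinor (((ε : ℤ) : ℂ) * Complex.I) u y) =
        ((ε : ℤ) : ℂ) • killingSpinor (((ε : ℤ) : ℂ) * Complex.I) u y ↔
      chirality k u + ((ε : ℤ) : ℂ) • gamma k i₀ u = 0 := by
  rw [← sub_eq_zero, thetaOp_killingSpinor_sub h₀ hy hc hs]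
  set w := chirality k u + ((ε : ℤ) : ℂ) • gamma k i₀ u with hw
  set z := w + (((ε : ℤ) : ℂ) * Complex.I) • gam k y w with hz
  constructor
  · intro h
    have hcos : (Real.cos θ : ℂ) ≠ 0 := by
      rw [hc]
      have : (Real.sqrt (1 + s ^ 2))⁻¹ ≠ 0 := by positivity
      exact_mod_cast this
    have hρ : (((Real.sqrt (conf y))⁻¹ : ℝ) : ℂ) ≠ 0 := by
      have := Real.sqrt_pos.2 (conf_pos hy.1)
      exact_mod_cast (inv_pos.2 this).ne'
    have hε : ((ε : ℤ) : ℂ) ≠ 0 := by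
      intro h0; simpa [h0] using units_mul_self_complex ε
    have h1 := (smul_eq_zero.1 h).resolve_left
      (neg_ne_zero.2 (mul_ne_zero (mul_ne_zero hρ hε) hcos))
    have h2 := congrArg (chirality k) h1
    simp only [map_add, map_smul, chirality_chirality, map_zero] at h2
    have hcs : (Real.sin θ : ℂ) ^ 2 + (Real.cos θ : ℂ) ^ 2 = 1 := by
      exact_mod_cast Real.sin_sq_add_cos_sq θ
    -- (cos θ Q - i sin θ)(cos θ Q + i sin θ) = 1.
    have hz0 : z = 0 := by
      linear_combination (norm := module) (Real.cos θ : ℂ) • h2 -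
        (Complex.I * (Real.sin θ : ℂ)) • h1 - hcs • z +
        Complex.I_mul_I • ((Real.sin θ : ℂ) ^ 2 • z)
    have h3 := congrArg (gam k y) hz0
    rw [hz] at hz0 h3
    simp only [map_add, map_smul, gam_gam_self, norm_sq_eq_conf, map_zero, Complex.ofReal_mul,
      Complex.ofReal_sub, Complex.ofReal_one, Complex.ofReal_ofNat] at h3
    -- (1 - J c(y))(1 + J c(y)) = 2Ω, which is nonzero in the ball.
    have h4 : (2 * ((conf y : ℝ) : ℂ)) • w = 0 := by
      linear_combination (norm := module) hz0 - (((ε : ℤ) : ℂ) * Complex.I) • h3 -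
        imaginary_mul_self ε • ((1 - 2 * ((conf y : ℝ) : ℂ)) • w)
    refine (smul_eq_zero.1 h4).resolve_left (mul_ne_zero two_ne_zero ?_)
    exact_mod_cast (conf_pos hy.1).ne'
  · intro h
    have : z = 0 := by rw [hz, h, map_zero, smul_zero, add_zero]
    rw [this, map_zero, smul_zero, smul_zero, add_zero, smul_zero]

/-! ### The vector of a spinor -/

/-- Clifford multiplication by a vector, multiplied by `i` so as to be Hermitian. -/
def hgam (k : ℕ) (v : Coord (2 * k)) : Spinor k →L[ℂ] Spinor k := Complex.I • gam k v

lemma hgam_apply (v : Coord (2 * k)) (x : Spinor k) : hgam k v x = Complex.I • gam k v x := rfl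

lemma inner_hgam_left (v : Coord (2 * k)) (x y : Spinor k) :
    ⟪hgam k v x, y⟫_ℂ = ⟪x, hgam k v y⟫_ℂ := by
  simp [hgam_apply, inner_gam_left, mul_comm]

lemma hgam_hgam_add (v w : Coord (2 * k)) (x : Spinor k) :
    hgam k v (hgam k w x) + hgam k w (hgam k v x) = ((2 * ⟪v, w⟫_ℝ : ℝ) : ℂ) • x := by
  simp only [hgam_apply, map_smul]
  have h := gam_gam_add v w x
  simp only [Complex.ofReal_mul, Complex.ofReal_neg, Complex.ofReal_ofNat] at h ⊢
  linear_combination (norm := module) -h +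
    Complex.I_mul_I • (gam k v (gam k w x) + gam k w (gam k v x))

lemma hgam_hgam_self (v : Coord (2 * k)) (x : Spinor k) :
    hgam k v (hgam k v x) = ((‖v‖ ^ 2 : ℝ) : ℂ) • x := by
  simp only [hgam_apply, map_smul, gam_gam_self]
  linear_combination (norm := module) -(Complex.I_mul_I • (((‖v‖ ^ 2 : ℝ) : ℂ) • x))

/-- The vector `(⟨i c(e_a) x, x⟩)_a` of a spinor `x`. -/
def spinVector (x : Spinor k) : Coord (2 * k) :=
  WithLp.toLp 2 fun a => (⟪x, hgam k (coordVec a) x⟫_ℂ).re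

lemma inner_hgam_im (v : Coord (2 * k)) (x : Spinor k) : (⟪x, hgam k v x⟫_ℂ).im = 0 := by
  rw [← Complex.conj_eq_iff_im, inner_conj_symm, inner_hgam_left]

lemma inner_hgam (v : Coord (2 * k)) (x : Spinor k) :
    ⟪x, hgam k v x⟫_ℂ = ((⟪spinVector x, v⟫_ℝ : ℝ) : ℂ) := by
  have h1 : ⟪x, hgam k v x⟫_ℂ = ∑ a, ((v a : ℝ) : ℂ) * ⟪x, hgam k (coordVec a) x⟫_ℂ := by
    simp only [hgam_apply, gam_coordVec, inner_smul_right]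
    rw [gam_apply, inner_sum, Finset.mul_sum]
    refine Finset.sum_congr rfl fun a _ => ?_
    rw [inner_smul_right]; ring
  rw [h1, inner_eq_sum, Complex.ofReal_sum]
  refine Finset.sum_congr rfl fun a _ => ?_
  have : ⟪x, hgam k (coordVec a) x⟫_ℂ = (((⟪x, hgam k (coordVec a) x⟫_ℂ).re : ℝ) : ℂ) := by
    apply Complex.ext <;> simp [inner_hgam_im]
  rw [this, ← Complex.ofReal_mul, mul_comm]
  rfl

lemma inner_self_complex (x : Spinor k) : ⟪x, x⟫_ℂ = ((‖x‖ ^ 2 : ℝ) : ℂ) := by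
  rw [inner_self_eq_norm_sq_to_K]; simp

/-- A spinor is of type I at a point if and only if its vector is null. -/
lemma typeI_at_iff {y : Coord (2 * k)} (hy : conf y ≠ 0) (x : Spinor k) :
    ((‖x‖ : ℝ) : ℂ) ^ 4 + ∑ a, ⟪cliff y (hypFrame a y) x, x⟫_ℂ ^ 2 = 0 ↔
      (‖x‖ ^ 2) ^ 2 = ‖spinVector x‖ ^ 2 := by
  have h : ∀ a, ⟪cliff y (hypFrame a y) x, x⟫_ℂ ^ 2 =
      -(((spinVector x a * spinVector x a : ℝ)) : ℂ) := by
    -- Clifford multiplication is skew-Hermitian, so ⟨c(e_a)x, x⟩ is purely imaginary and its square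
    -- is minus that of the real component.
    intro a
    have h1 := inner_hgam (coordVec a) x
    rw [inner_coordVec, hgam_apply, gam_coordVec, inner_smul_right] at h1
    rw [cliff_hypFrame a hy, inner_gamma_left, Complex.ofReal_mul, ← h1]
    linear_combination (⟪x, gamma k a x⟫_ℂ ^ 2) * Complex.I_mul_I
  simp only [h, Finset.sum_neg_distrib]
  rw [← Complex.ofReal_sum, norm_sq_eq_sum, ← sub_eq_add_neg, sub_eq_zero]
  constructor
  · intro h
    have : ‖x‖ ^ 4 = ‖spinVector x‖ ^ 2 := by exact_mod_cast h
    rw [← this]; ring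
  · intro h
    rw [← h]; push_cast; ring

lemma killingSpinor_eq (ε : ℤˣ) (u : Spinor k) (y : Coord (2 * k)) :
    killingSpinor (((ε : ℤ) : ℂ) * Complex.I) u y =
      (((Real.sqrt (conf y))⁻¹ : ℝ) : ℂ) • (u - (((ε : ℤ) : ℝ) : ℂ) • hgam k y u) := by
  rw [killingSpinor, ← Complex.coe_smul, hgam_apply, smul_smul, Complex.ofReal_intCast]

/-- Write h(v) = i c(v). Expanding (1 - εh(y)) h(v) (1 - εh(y)), the cubic term reduces by
h(y)h(v)h(y) = 2⟨y,v⟩h(y) - |y|²h(v) and the mixed ones by the Clifford relation. -/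
lemma spinVector_killingSpinor (ε : ℤˣ) (u : Spinor k) {y : Coord (2 * k)} (hy : ‖y‖ < 1) :
    spinVector (killingSpinor (((ε : ℤ) : ℂ) * Complex.I) u y) = (2 : ℝ) • spinVector u +
      (2 * (conf y)⁻¹ * (⟪spinVector u, y⟫_ℝ - ((ε : ℤ) : ℝ) * ‖u‖ ^ 2)) • y := by
  refine ext_inner_right ℝ fun v => ?_
  have hc := conf_pos hy
  have hρ : (Real.sqrt (conf y))⁻¹ * (Real.sqrt (conf y))⁻¹ = (conf y)⁻¹ := by
    rw [← mul_inv, Real.mul_self_sqrt hc.le]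
  have hε : ((ε : ℤ) : ℝ) * ((ε : ℤ) : ℝ) = 1 := by
    rw [← Int.cast_mul, Int.units_coe_mul_self, Int.cast_one]
  have h1 : ⟪u, hgam k y (hgam k v (hgam k y u))⟫_ℂ =
      ((2 * ⟪y, v⟫_ℝ * ⟪spinVector u, y⟫_ℝ - ‖y‖ ^ 2 * ⟪spinVector u, v⟫_ℝ : ℝ) : ℂ) := by
    have : hgam k y (hgam k v (hgam k y u)) = ((2 * ⟪y, v⟫_ℝ : ℝ) : ℂ) • hgam k y u -
        ((‖y‖ ^ 2 : ℝ) : ℂ) • hgam k v u := by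
      rw [← hgam_hgam_add, hgam_hgam_self, map_smul]; abel
    rw [this, inner_sub_right, inner_smul_right, inner_smul_right, inner_hgam, inner_hgam]
    push_cast; ring
  have h2 : ⟪u, hgam k y (hgam k v u)⟫_ℂ + ⟪u, hgam k v (hgam k y u)⟫_ℂ =
      ((2 * ⟪y, v⟫_ℝ * ‖u‖ ^ 2 : ℝ) : ℂ) := by
    rw [← inner_add_right, hgam_hgam_add, inner_smul_right, inner_self_complex,
      ← Complex.ofReal_mul]
  have h3 := inner_hgam v (killingSpinor (((ε : ℤ) : ℂ) * Complex.I) u y)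
  rw [killingSpinor_eq] at h3 ⊢
  simp only [map_smul, map_sub, inner_smul_left, inner_smul_right, inner_sub_left,
    inner_sub_right, inner_hgam_left, Complex.conj_ofReal] at h3
  rw [h1, inner_hgam] at h3
  have h4 : ((⟪spinVector ((((Real.sqrt (conf y))⁻¹ : ℝ) : ℂ) •
      (u - (((ε : ℤ) : ℝ) : ℂ) • hgam k y u)), v⟫_ℝ : ℝ) : ℂ) =
      (((conf y)⁻¹ * (⟪spinVector u, v⟫_ℝ - ((ε : ℤ) : ℝ) * (2 * ⟪y, v⟫_ℝ * ‖u‖ ^ 2) +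
        (2 * ⟪y, v⟫_ℝ * ⟪spinVector u, y⟫_ℝ - ‖y‖ ^ 2 * ⟪spinVector u, v⟫_ℝ)) : ℝ) : ℂ) := by
    rw [← h3, ← hρ]
    have hε' : (((ε : ℤ) : ℝ) : ℂ) * (((ε : ℤ) : ℝ) : ℂ) = 1 := by exact_mod_cast hε
    simp only [Complex.ofReal_mul, Complex.ofReal_sub, Complex.ofReal_add] at h2 ⊢
    generalize (((ε : ℤ) : ℝ) : ℂ) = e at *
    generalize (((Real.sqrt (conf y))⁻¹ : ℝ) : ℂ) = ρ
    rw [← h2]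
    linear_combination (ρ * ρ * (((2 : ℝ) : ℂ) * (⟪y, v⟫_ℝ : ℂ) * (⟪spinVector u, y⟫_ℝ : ℂ)
      - ((‖y‖ ^ 2 : ℝ) : ℂ) * (⟪spinVector u, v⟫_ℝ : ℂ))) * hε'
  have h5 := Complex.ofReal_injective h4
  rw [h5, inner_add_left, real_inner_smul_left, real_inner_smul_left, norm_sq_eq_conf y]
  have := hc.ne'
  field_simp
  ring

/-- |(1 - εh(y))u|² = (1 + |y|²)|u|² - 2ε⟨ξ(u), y⟩ for h = `hgam` and ξ = `spinVector`, and 1 + |y|²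
= 2(1 - Ω). -/
lemma normSqFun_killingSpinor (ε : ℤˣ) (u : Spinor k) {y : Coord (2 * k)} (hy : ‖y‖ < 1) :
    normSqFun (killingSpinor (((ε : ℤ) : ℂ) * Complex.I) u) y =
      staticFun (2 * ‖u‖ ^ 2) ((-2 * ((ε : ℤ) : ℝ)) • spinVector u) y := by
  have hc := conf_pos hy
  have hρ : (Real.sqrt (conf y))⁻¹ * (Real.sqrt (conf y))⁻¹ = (conf y)⁻¹ := by
    rw [← mul_inv, Real.mul_self_sqrt hc.le]
  have hε : ((ε : ℤ) : ℝ) * ((ε : ℤ) : ℝ) = 1 := by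
    rw [← Int.cast_mul, Int.units_coe_mul_self, Int.cast_one]
  have h1 : ((normSqFun (killingSpinor (((ε : ℤ) : ℂ) * Complex.I) u) y : ℝ) : ℂ) =
      (((conf y)⁻¹ * (‖u‖ ^ 2 - 2 * ((ε : ℤ) : ℝ) * ⟪spinVector u, y⟫_ℝ +
        ‖y‖ ^ 2 * ‖u‖ ^ 2) : ℝ) : ℂ) := by
    rw [normSqFun, ← inner_self_complex, killingSpinor_eq]
    simp only [inner_smul_left, inner_smul_right, inner_sub_left,
      inner_sub_right, inner_hgam_left, Complex.conj_ofReal, hgam_hgam_self, inner_hgam]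
    rw [inner_self_complex, ← hρ]
    have hε' : (((ε : ℤ) : ℝ) : ℂ) * (((ε : ℤ) : ℝ) : ℂ) = 1 := by exact_mod_cast hε
    simp only [Complex.ofReal_mul, Complex.ofReal_sub, Complex.ofReal_add, Complex.ofReal_ofNat]
    generalize (((ε : ℤ) : ℝ) : ℂ) = e at *
    generalize (((Real.sqrt (conf y))⁻¹ : ℝ) : ℂ) = ρ
    linear_combination (ρ * ρ * (((‖y‖ ^ 2 : ℝ) : ℂ) * ((‖u‖ ^ 2 : ℝ) : ℂ))) * hε'
  rw [Complex.ofReal_injective h1, staticFun, real_inner_smul_left, norm_sq_eq_conf y]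
  have := hc.ne'
  field_simp
  ring

/-- Being of type I is independent of the point for an imaginary Killing spinor. -/
lemma typeI_at_killingSpinor_iff (ε : ℤˣ) (u : Spinor k) {y : Coord (2 * k)} (hy : ‖y‖ < 1) :
    (‖killingSpinor (((ε : ℤ) : ℂ) * Complex.I) u y‖ ^ 2) ^ 2 =
        ‖spinVector (killingSpinor (((ε : ℤ) : ℂ) * Complex.I) u y)‖ ^ 2 ↔
      (‖u‖ ^ 2) ^ 2 = ‖spinVector u‖ ^ 2 := by
  have hc := (conf_pos hy).ne'
  have hε : ((ε : ℤ) : ℝ) ^ 2 = 1 := by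
    rw [sq, ← Int.cast_mul, Int.units_coe_mul_self, Int.cast_one]
  have h1 := normSqFun_killingSpinor ε u hy
  rw [normSqFun, staticFun, real_inner_smul_left] at h1
  rw [h1, spinVector_killingSpinor ε u hy, ← sub_eq_zero, ← sub_eq_zero (a := (‖u‖ ^ 2) ^ 2)]
  -- The Lorentzian square of (|Φ|², ξ(Φ)) is the same at every point of the ball, namely 4 times
  -- that of (|u|², ξ(u)).
  have h2 : ((2 * ‖u‖ ^ 2 + -2 * ((ε : ℤ) : ℝ) * ⟪spinVector u, y⟫_ℝ) * (conf y)⁻¹ -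
      2 * ‖u‖ ^ 2) ^ 2 - ‖(2 : ℝ) • spinVector u +
      (2 * (conf y)⁻¹ * (⟪spinVector u, y⟫_ℝ - ((ε : ℤ) : ℝ) * ‖u‖ ^ 2)) • y‖ ^ 2 =
      4 * ((‖u‖ ^ 2) ^ 2 - ‖spinVector u‖ ^ 2) := by
    rw [← real_inner_self_eq_norm_sq (_ + _)]
    simp only [inner_add_left, inner_add_right, real_inner_smul_left, real_inner_smul_right,
      real_inner_comm (spinVector u) y]
    rw [real_inner_self_eq_norm_sq, real_inner_self_eq_norm_sq, norm_sq_eq_conf y]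
    generalize ((ε : ℤ) : ℝ) = e at *
    generalize ⟪spinVector u, y⟫_ℝ = p
    have hw : (conf y)⁻¹ * conf y = 1 := inv_mul_cancel₀ hc
    generalize (conf y)⁻¹ = w at *
    linear_combination (4 * w ^ 2 * (p ^ 2 - (‖u‖ ^ 2) ^ 2) + 8 * w * (‖u‖ ^ 2) ^ 2) * hε +
      8 * w * (p - e * ‖u‖ ^ 2) ^ 2 * hw
  rw [h2]
  constructor <;> intro h <;> linarith

end Density

/-! ### Spinors with a prescribed null vector -/

section Existence

variable {k : ℕ}

lemma chirality_hgam (v : Coord (2 * k)) (x : Spinor k) :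
    chirality k (hgam k v x) = -hgam k v (chirality k x) := by
  rw [hgam_apply, hgam_apply, map_smul, chirality_gam, smul_neg]

lemma gamma_hgam {v : Coord (2 * k)} {i : Fin (2 * k)} (hv : v i = 0) (x : Spinor k) :
    gamma k i (hgam k v x) = -hgam k v (gamma k i x) := by
  have h := gam_gam_comm v (coordVec i) x
  rw [gam_coordVec, gam_coordVec, inner_coordVec, hv, mul_zero, Complex.ofReal_zero, zero_smul,
    add_zero] at h
  rw [hgam_apply, hgam_apply, map_smul, h, smul_neg]

/-- For v ⊥ ∂_1, i c(v) anticommutes with both Q and c(∂_1), hence preserves the space of boundary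
values. -/
lemma boundary_hgam {v : Coord (2 * k)} {i : Fin (2 * k)} (hv : v i = 0) {ε : ℤˣ} {x : Spinor k}
    (hx : chirality k x + ((ε : ℤ) : ℂ) • gamma k i x = 0) :
    chirality k (hgam k v x) + ((ε : ℤ) : ℂ) • gamma k i (hgam k v x) = 0 := by
  have h := congrArg (hgam k v) hx
  rw [map_add, map_smul, map_zero] at h
  rw [chirality_hgam, gamma_hgam hv]
  linear_combination (norm := module) -h

/-- The vector of a boundary value is tangent. -/
lemma spinVector_apply_eq_zero {i : Fin (2 * k)} {ε : ℤˣ} {x : Spinor k}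
    (hx : chirality k x + ((ε : ℤ) : ℂ) • gamma k i x = 0) : spinVector x i = 0 := by
  have h1 := inner_hgam (coordVec i) x
  -- Thus ⟨x, i c(∂_1)x⟩ = -εi⟨x, Qx⟩. The left side is real, and the right side is imaginary
  -- because Q is Hermitian; so both vanish.
  have h2 : gamma k i x = -(((ε : ℤ) : ℂ) • chirality k x) := by
    linear_combination (norm := module) ((ε : ℤ) : ℂ) • hx -
      units_mul_self_complex ε • gamma k i x
  rw [inner_coordVec, hgam_apply, gam_coordVec, h2, inner_smul_right, inner_neg_right,
    inner_smul_right] at h1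
  have h3 : (⟪x, chirality k x⟫_ℂ).im = 0 := by
    rw [← Complex.conj_eq_iff_im, inner_conj_symm, inner_chirality_left]
  have h4 := congrArg Complex.re h1
  simpa [h3] using h4.symm

/-- The expectation of h(v)h(w) + h(w)h(v) in x, with h = `hgam`, is 2⟨v,w⟩|x|² by the Clifford
relation, and twice the expectation of h(w) by h(v)x = x. -/
lemma spinVector_eq_of_hgam_eq {v : Coord (2 * k)} {x : Spinor k} (hx : hgam k v x = x) :
    spinVector x = ‖x‖ ^ 2 • v := by
  refine ext_inner_right ℝ fun w => ?_
  have h1 : ⟪x, hgam k v (hgam k w x) + hgam k w (hgam k v x)⟫_ℂ =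
      ((2 * ⟪spinVector x, w⟫_ℝ : ℝ) : ℂ) := by
    rw [inner_add_right, ← inner_hgam_left, hx, inner_hgam]
    push_cast; ring
  rw [hgam_hgam_add, inner_smul_right, inner_self_complex, ← Complex.ofReal_mul] at h1
  have h2 := Complex.ofReal_injective h1
  rw [real_inner_smul_left]
  linarith

/-- This is where n ≥ 3 enters: the hyperplane orthogonal to ∂_1 must have dimension at least 2 to
contain a vector orthogonal to v. -/
lemma exists_orthogonal (hk : 2 ≤ k) {i₀ : Fin (2 * k)} (hi : i₀.val = 0)
    (v : Coord (2 * k)) : ∃ w : Coord (2 * k), w ≠ 0 ∧ w i₀ = 0 ∧ ⟪v, w⟫_ℝ = 0 := by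
  set i₁ : Fin (2 * k) := ⟨1, by omega⟩
  set i₂ : Fin (2 * k) := ⟨2, by omega⟩
  have h01 : i₀ ≠ i₁ := fun h => by simpa [hi, i₁] using congrArg Fin.val h
  have h02 : i₀ ≠ i₂ := fun h => by simpa [hi, i₂] using congrArg Fin.val h
  have h12 : i₁ ≠ i₂ := fun h => by simpa [i₁, i₂] using congrArg Fin.val h
  by_cases h1 : v i₁ = 0
  · refine ⟨coordVec i₁, fun h => ?_, ?_, ?_⟩
    · have := congrArg (fun z : Coord (2 * k) => z i₁) h
      simp [coordVec_apply] at this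
    · rw [coordVec_apply, if_neg h01]
    · rw [inner_coordVec, h1]
  · refine ⟨v i₂ • coordVec i₁ - v i₁ • coordVec i₂, fun h => ?_, ?_, ?_⟩
    · have := congrArg (fun z : Coord (2 * k) => z i₂) h
      simp [coordVec_apply, h12.symm, h1] at this
    · simp [coordVec_apply, h01, h02]
    · rw [inner_sub_right, real_inner_smul_right, real_inner_smul_right, inner_coordVec,
        inner_coordVec]
      ring

/-- P = εQγ_i is an involution and the condition says Px = -x. Either z - Pz is a nonzero solution,
or Pz = z and γ_i z is one, as γ_i anticommutes with P. -/
lemma exists_boundary_spinor (i : Fin (2 * k)) (ε : ℤˣ) :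
    ∃ x : Spinor k, x ≠ 0 ∧ chirality k x + ((ε : ℤ) : ℂ) • gamma k i x = 0 := by
  obtain ⟨z, hz⟩ := exists_ne (0 : Spinor k)
  have hε := units_mul_self_complex ε
  by_cases h : z - ((ε : ℤ) : ℂ) • chirality k (gamma k i z) = 0
  · refine ⟨gamma k i z, fun h0 => hz ?_, ?_⟩
    · rw [← neg_eq_zero, ← gamma_gamma_self i z, h0, map_zero]
    · rw [gamma_gamma_self]
      linear_combination (norm := module) (-((ε : ℤ) : ℂ)) • h -
        hε • chirality k (gamma k i z)
  · refine ⟨_, h, ?_⟩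
    simp only [map_sub, map_smul, chirality_chirality, chirality_gamma, map_neg, gamma_gamma_self]
    linear_combination (norm := module) -(hε • chirality k z)

lemma exists_boundary_spinor_hgam_eq (hk : 2 ≤ k) {i₀ : Fin (2 * k)} (hi : i₀.val = 0)
    {v : Coord (2 * k)} (hv : v i₀ = 0) (hv1 : ‖v‖ = 1) (ε : ℤˣ) :
    ∃ x : Spinor k, x ≠ 0 ∧ chirality k x + ((ε : ℤ) : ℂ) • gamma k i₀ x = 0 ∧
      hgam k v x = x := by
  obtain ⟨x, hx0, hx⟩ := exists_boundary_spinor i₀ ε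
  -- x + i c(v)x is the projection to the +1 eigenspace, up to a factor. If it vanishes, x has
  -- eigenvalue -1, and i c(w) with w ⊥ v moves it to eigenvalue +1.
  by_cases h : x + hgam k v x = 0
  · obtain ⟨w, hw0, hwi, hvw⟩ := exists_orthogonal hk hi v
    refine ⟨hgam k w x, fun h0 => hx0 ?_, boundary_hgam hwi hx, ?_⟩
    · have h1 := hgam_hgam_self w x
      rw [h0, map_zero] at h1
      refine (smul_eq_zero.1 h1.symm).resolve_left ?_
      have : ‖w‖ ^ 2 ≠ 0 := pow_ne_zero 2 (norm_ne_zero_iff.2 hw0)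
      exact_mod_cast this
    · have h1 := hgam_hgam_add v w x
      rw [hvw, mul_zero, Complex.ofReal_zero, zero_smul] at h1
      have h2 := congrArg (hgam k w) h
      rw [map_add, map_zero] at h2
      linear_combination (norm := module) h1 - h2
  · refine ⟨_, h, ?_, ?_⟩
    · have h1 := boundary_hgam hv hx
      rw [map_add, map_add]
      linear_combination (norm := module) hx + h1
    · rw [map_add, hgam_hgam_self, hv1]
      simp [add_comm]

end Existence

/-! ### The future cone in terms of the coefficients -/

section Cone

variable {n : ℕ} {i₀ : Fin n} (h₀ : i₀.succ = 1) (s : ℝ)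
include h₀

lemma zero_ne_one_fin : (0 : Fin (n + 1)) ≠ 1 := h₀ ▸ (Fin.succ_ne_zero i₀).symm

omit h₀ in
lemma sum_potIndex {M : Type*} [AddCommMonoid M] (f : Fin (n + 1) → M) (hf : f 1 = 0) :
    ∑ i : PotIndex n, f i.1 = f 0 + ∑ j : Fin n, f j.succ := by
  rw [← Fin.sum_univ_succ, ← Finset.sum_subtype (Finset.univ.erase 1) (by simp) f,
    Finset.sum_erase _ hf]

lemma staticFun_mem_staticSpace (A : ℝ) {B : Coord n} (hB : B i₀ = 0) :
    (hypDomain n s).domRestrict (staticFun A B) ∈ staticSpace n s := by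
  have h : (hypDomain n s).domRestrict (staticFun A B) =
      A • (hypDomain n s).domRestrict (potV 0) +
        ∑ j : Fin n, B j • (hypDomain n s).domRestrict (potV j.succ) := by
    ext y
    simp [Set.domRestrict_apply, staticFun_eq_sum A B y.2.1]
  have hm : ∀ i : Fin (n + 1), i ≠ 1 → (hypDomain n s).domRestrict (potV i) ∈ staticSpace n s :=
    fun i hi => Submodule.subset_span ⟨⟨i, hi⟩, rfl⟩
  rw [h]
  refine Submodule.add_mem _ (Submodule.smul_mem _ _ (hm 0 (zero_ne_one_fin h₀)))
    (Submodule.sum_mem _ fun j _ => ?_)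
  by_cases hj : j = i₀
  · rw [hj, hB, zero_smul]; exact Submodule.zero_mem _
  · refine Submodule.smul_mem _ _ (hm _ fun h => hj ?_)
    rw [← h₀] at h
    exact Fin.succ_injective _ h

/-- In the coefficients (A, B) the Lorentzian square is A² - |B|² and the product with V_(0) is A.
-/
lemma mem_futureCone_iff (V : hypDomain n s → ℝ) :
    V ∈ futureCone n s ↔ ∃ (A : ℝ) (B : Coord n), B i₀ = 0 ∧ 0 < A ∧ ‖B‖ ^ 2 = A ^ 2 ∧
      V = (hypDomain n s).domRestrict (staticFun A B) := by
  have key : ∀ q : Fin (n + 1) → ℝ, q 1 = 0 →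
      (∑ i : PotIndex n, q i.1 • (hypDomain n s).domRestrict (potV i.1) =
        (hypDomain n s).domRestrict (staticFun (q 0) (WithLp.toLp 2 fun j => q j.succ))) ∧
      lorentz (fun i : PotIndex n => q i.1) (fun i => q i.1) =
        q 0 ^ 2 - ‖(WithLp.toLp 2 fun j => q j.succ : Coord n)‖ ^ 2 ∧
      lorentz (fun i : PotIndex n => q i.1) (fun i => if i.1 = 0 then 1 else 0) = q 0 := by
    intro q hq
    refine ⟨?_, ?_, ?_⟩
    · rw [sum_potIndex (fun i => q i • (hypDomain n s).domRestrict (potV i)) (by simp [hq])]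
      ext y
      simp [Set.domRestrict_apply, staticFun_eq_sum _ _ y.2.1]
    · rw [lorentz, sum_potIndex (fun i => (if i = 0 then 1 else -1) * q i * q i)
        (by simp [hq]), ← norm_sq_eq_sum]
      simp [Fin.succ_ne_zero]
      ring
    · rw [lorentz, sum_potIndex
        (fun i => (if i = 0 then 1 else -1) * q i * (if i = 0 then 1 else 0)) (by simp [hq])]
      simp [Fin.succ_ne_zero]
  constructor
  · rintro ⟨p, rfl, h1, h2⟩
    -- The coefficients are extended by 0 to the excluded index 1, so that sums can run over all
    -- indices.
    set q : Fin (n + 1) → ℝ := fun i => if h : i ≠ 1 then p ⟨i, h⟩ else 0 with hq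
    have hp : p = fun i => q i.1 := by
      ext i; simp [hq, i.2]
    have hq1 : q 1 = 0 := by simp [hq]
    obtain ⟨e1, e2, e3⟩ := key q hq1
    rw [hp] at h1 h2 ⊢
    rw [e2] at h1
    rw [e3] at h2
    refine ⟨q 0, WithLp.toLp 2 fun j => q j.succ, ?_, h2, by linarith, e1⟩
    simp [h₀, hq1]
  · rintro ⟨A, B, hB, hA, hAB, rfl⟩
    set q : Fin (n + 1) → ℝ := Fin.cases A (fun j => B j) with hq
    have hq1 : q 1 = 0 := by rw [← h₀]; simp [hq, hB]
    obtain ⟨e1, e2, e3⟩ := key q hq1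
    have hB' : (WithLp.toLp 2 fun j => q j.succ : Coord n) = B := by ext j; simp [hq]
    have hA' : q 0 = A := rfl
    rw [hB', hA'] at e1 e2
    rw [hA'] at e3
    exact ⟨fun i => q i.1, e1.symm, by rw [e2, hAB, sub_self], by rwa [e3]⟩

end Cone

/-! ### Classification of the θ-Killing spinors and proof of the three claims -/

lemma cos_sin_of_umbilicity {θ s : ℝ} (hθ : θ ∈ Set.Ioo (-(Real.pi / 2)) (Real.pi / 2))
    (hs : umbilicity s = Real.sin θ) :
    Real.cos θ = (Real.sqrt (1 + s ^ 2))⁻¹ ∧ Real.sin θ = s * Real.cos θ := by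
  have hr : 0 < Real.sqrt (1 + s ^ 2) := by positivity
  have hr2 : Real.sqrt (1 + s ^ 2) ^ 2 = 1 + s ^ 2 := Real.sq_sqrt (by positivity)
  -- The range of θ selects the positive root in cos²θ = 1 - λ_s² = 1/(1 + s²).
  have hc := Real.cos_pos_of_mem_Ioo hθ
  rw [umbilicity] at hs
  have h1 : Real.cos θ = (Real.sqrt (1 + s ^ 2))⁻¹ := by
    have h2 : Real.cos θ ^ 2 = ((Real.sqrt (1 + s ^ 2))⁻¹) ^ 2 := by
      rw [Real.cos_sq', ← hs, div_pow, inv_pow, hr2]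
      field_simp
      ring
    exact (sq_eq_sq₀ hc.le (inv_nonneg.2 hr.le)).1 h2
  exact ⟨h1, by rw [h1, ← hs, div_eq_mul_inv]⟩

lemma eq_zero_of_killingSpinor_eq_zero {k : ℕ} {J : ℂ} (hJ : J * J = -1) {u : Spinor k}
    {y : Coord (2 * k)} (hy : ‖y‖ < 1) (h : killingSpinor J u y = 0) : u = 0 := by
  have hc := conf_pos hy
  rw [killingSpinor] at h
  have h1 := (smul_eq_zero.1 h).resolve_left (inv_ne_zero (Real.sqrt_pos.2 hc).ne')
  have h2 := congrArg (gam k y) h1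
  simp only [map_sub, map_smul, gam_gam_self, norm_sq_eq_conf, map_zero, Complex.ofReal_mul,
    Complex.ofReal_sub, Complex.ofReal_one, Complex.ofReal_ofNat] at h2
  have h3 : (2 * ((conf y : ℝ) : ℂ)) • u = 0 := by
    linear_combination (norm := module) h1 + J • h2 -
      hJ • ((1 - 2 * ((conf y : ℝ) : ℂ)) • u)
  refine (smul_eq_zero.1 h3).resolve_left (mul_ne_zero two_ne_zero ?_)
  exact_mod_cast hc.ne'

/-- The classification of the imaginary Killing spinors with the `θ`-boundary condition. -/
lemma isThetaKilling_iff {k : ℕ} {i₀ : Fin (2 * k)} (h₀ : i₀.succ = 1) {θ s : ℝ}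
    (hθ : θ ∈ Set.Ioo (-(Real.pi / 2)) (Real.pi / 2)) (hs : umbilicity s = Real.sin θ) (ε : ℤˣ)
    (Φ : Coord (2 * k) → Spinor k) :
    IsThetaKilling ε θ s Φ ↔ ∃ u : Spinor k,
      chirality k u + ((ε : ℤ) : ℂ) • gamma k i₀ u = 0 ∧
      Set.EqOn Φ (killingSpinor (((ε : ℤ) : ℂ) * Complex.I) u) (hypDomain (2 * k) s) := by
  obtain ⟨hc, hsc⟩ := cos_sin_of_umbilicity hθ hs
  have hJ := imaginary_mul_self ε
  constructor
  · rintro ⟨h1, h2, h3⟩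
    obtain ⟨u, hu⟩ := exists_eq_killingSpinor hJ h₀ h1 (by simpa only [mul_div_assoc] using h2)
    -- One boundary point suffices to extract the condition on u.
    obtain ⟨y, hy⟩ := hypBoundary_nonempty h₀ s
    refine ⟨u, ?_, hu⟩
    rw [← thetaOp_killingSpinor_iff h₀ hy hc hsc, ← hu (hypBoundary_subset s hy)]
    exact h3 y hy
  · rintro ⟨u, hu, hΦ⟩
    refine ⟨((contDiffOn_killingSpinor _ u).mono fun _ hy => hy.1).congr hΦ, fun y hy X => ?_,
      fun y hy => ?_⟩
    · have h := killingSpinor_killing hJ u h₀ s hy X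
      rw [spinDeriv_eq _ _ _ (conf_pos hy.1).ne'] at h ⊢
      rw [fderivWithin_congr hΦ (hΦ hy), hΦ hy, ← mul_div_assoc]
      exact h
    · rw [hΦ (hypBoundary_subset s hy)]
      exact (thetaOp_killingSpinor_iff h₀ hy hc hsc ε u).2 hu

end HypSpin

end

theorem proposition4p1 (k : ℕ) (hk : 1 ≤ k) (θ s : ℝ)
    (hθ : θ ∈ Set.Ioo (-(Real.pi / 2)) (Real.pi / 2)) (hs : umbilicity s = Real.sin θ) (ε : ℤˣ) :
    (∀ Φ : Coord (2 * k) → Spinor k, IsThetaKilling ε θ s Φ →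
      (hypDomain (2 * k) s).domRestrict (normSqFun Φ) ∈ staticSpace (2 * k) s ∧
      SolvesStatic (2 * k) s (normSqFun Φ)) ∧
    (∀ Φ : Coord (2 * k) → Spinor k, IsThetaKilling ε θ s Φ → IsNontrivial s Φ → IsTypeI s Φ →
      (hypDomain (2 * k) s).domRestrict (normSqFun Φ) ∈ futureCone (2 * k) s) ∧
    (2 ≤ k → ∀ V ∈ futureCone (2 * k) s, ∃ Φ : Coord (2 * k) → Spinor k,
      IsThetaKilling ε θ s Φ ∧ IsNontrivial s Φ ∧ IsTypeI s Φ ∧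
      V = (hypDomain (2 * k) s).domRestrict (normSqFun Φ)) := by
  obtain ⟨i₀, hi₀⟩ : ∃ i : Fin (2 * k), i.val = 0 := ⟨⟨0, by omega⟩, rfl⟩
  have h₀ : i₀.succ = 1 := by
    ext
    rw [Fin.val_succ, hi₀, Fin.val_one', Nat.mod_eq_of_lt (by omega)]
  have hε : ((ε : ℤ) : ℝ) * ((ε : ℤ) : ℝ) = 1 := by
    rw [← Int.cast_mul, Int.units_coe_mul_self, Int.cast_one]
  have hnorm : ∀ (Φ : Coord (2 * k) → Spinor k) (u : Spinor k),
      Set.EqOn Φ (killingSpinor (((ε : ℤ) : ℂ) * Complex.I) u) (hypDomain (2 * k) s) →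
      Set.EqOn (normSqFun Φ) (staticFun (2 * ‖u‖ ^ 2) ((-2 * ((ε : ℤ) : ℝ)) • spinVector u))
        (hypDomain (2 * k) s) := fun Φ u hΦ y hy => by
    rw [← normSqFun_killingSpinor ε u hy.1, normSqFun, normSqFun, hΦ hy]
  have hres : ∀ (Φ : Coord (2 * k) → Spinor k) (u : Spinor k),
      Set.EqOn Φ (killingSpinor (((ε : ℤ) : ℂ) * Complex.I) u) (hypDomain (2 * k) s) →
      (hypDomain (2 * k) s).domRestrict (normSqFun Φ) = (hypDomain (2 * k) s).domRestrict
        (staticFun (2 * ‖u‖ ^ 2) ((-2 * ((ε : ℤ) : ℝ)) • spinVector u)) :=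
    fun Φ u hΦ => funext fun y => hnorm Φ u hΦ y.2
  obtain ⟨y₀, hy₀⟩ := hypBoundary_nonempty h₀ s
  replace hy₀ := hypBoundary_subset s hy₀
  refine ⟨fun Φ hΦ => ?_, fun Φ hΦ hne hI => ?_, fun hk2 V hV => ?_⟩
  · obtain ⟨u, hu, hΦu⟩ := (isThetaKilling_iff h₀ hθ hs ε Φ).1 hΦ
    have hB : ((-2 * ((ε : ℤ) : ℝ)) • spinVector u) i₀ = 0 := by
      rw [PiLp.smul_apply, spinVector_apply_eq_zero hu, smul_zero]
    rw [hres Φ u hΦu]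
    exact ⟨staticFun_mem_staticSpace h₀ s _ hB,
      (solvesStatic_staticFun h₀ s _ hB).congr s (hnorm Φ u hΦu)⟩
  · obtain ⟨u, hu, hΦu⟩ := (isThetaKilling_iff h₀ hθ hs ε Φ).1 hΦ
    have hu0 : u ≠ 0 := by
      rintro rfl
      obtain ⟨y, hy, hy0⟩ := hne
      exact hy0 (by rw [hΦu hy, killingSpinor, map_zero, smul_zero, sub_zero, smul_zero])
    have hn := hI y₀ hy₀
    rw [typeI_at_iff (conf_pos hy₀.1).ne', hΦu hy₀, typeI_at_killingSpinor_iff ε u hy₀.1] at hn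
    rw [hres Φ u hΦu, mem_futureCone_iff h₀]
    refine ⟨_, _, ?_, ?_, ?_, rfl⟩
    · rw [PiLp.smul_apply, spinVector_apply_eq_zero hu, smul_zero]
    · have := norm_pos_iff.2 hu0
      positivity
    · rw [norm_smul, mul_pow, ← hn, Real.norm_eq_abs, sq_abs]
      linear_combination 4 * (‖u‖ ^ 2) ^ 2 * hε
  · obtain ⟨A, B, hB, hA, hAB, rfl⟩ := (mem_futureCone_iff h₀ s V).1 hV
    have hBA : ‖B‖ = A := (sq_eq_sq₀ (norm_nonneg _) hA.le).1 hAB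
    -- Since B must equal -2ε ξ(u) and ξ(u) = |u|² v with 2|u|² = A, the required unit vector is v =
    -- -εB/A.
    have hv : ((-((ε : ℤ) : ℝ) * A⁻¹) • B) i₀ = 0 := by rw [PiLp.smul_apply, hB, smul_zero]
    have hv1 : ‖(-((ε : ℤ) : ℝ) * A⁻¹) • B‖ = 1 := by
      have : ‖(-((ε : ℤ) : ℝ) * A⁻¹) • B‖ ^ 2 = 1 ^ 2 := by
        rw [norm_smul, hBA, mul_pow, Real.norm_eq_abs, sq_abs]
        field_simp
        linear_combination hε
      exact (sq_eq_sq₀ (norm_nonneg _) zero_le_one).1 this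
    obtain ⟨x, hx0, hx, hvx⟩ := exists_boundary_spinor_hgam_eq hk2 hi₀ hv hv1 ε
    -- The scaling makes |u|² = A/2, so that the coefficient 2|u|² of V_(0) is A.
    set c : ℝ := Real.sqrt (A / 2) / ‖x‖ with hc
    set u : Spinor k := (c : ℂ) • x with hu
    have hxn := norm_pos_iff.2 hx0
    have hun : ‖u‖ ^ 2 = A / 2 := by
      rw [hu, norm_smul, mul_pow, Complex.norm_real, Real.norm_eq_abs, sq_abs, hc, div_pow,
        Real.sq_sqrt (by positivity)]
      field_simp
    have hu0 : u ≠ 0 := by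
      intro h0
      rw [h0, norm_zero] at hun
      have : (0 : ℝ) < A / 2 := by positivity
      rw [← hun] at this
      simp at this
    have hub : chirality k u + ((ε : ℤ) : ℂ) • gamma k i₀ u = 0 := by
      rw [hu, map_smul, map_smul]
      linear_combination (norm := module) (c : ℂ) • hx
    have huv : hgam k ((-((ε : ℤ) : ℝ) * A⁻¹) • B) u = u := by rw [hu, map_smul, hvx]
    have hsv := spinVector_eq_of_hgam_eq huv
    have hK := Set.eqOn_refl (killingSpinor (((ε : ℤ) : ℂ) * Complex.I) u) (hypDomain (2 * k) s)
    clear_value u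
    have htype : (‖u‖ ^ 2) ^ 2 = ‖spinVector u‖ ^ 2 := by
      rw [hsv, norm_smul, hv1, mul_one, Real.norm_of_nonneg (by positivity)]
    refine ⟨killingSpinor (((ε : ℤ) : ℂ) * Complex.I) u,
      (isThetaKilling_iff h₀ hθ hs ε _).2 ⟨u, hub, hK⟩, ?_, fun y hy => ?_, ?_⟩
    · refine ⟨y₀, hy₀, fun h0 => hu0 ?_⟩
      exact eq_zero_of_killingSpinor_eq_zero (imaginary_mul_self ε) hy₀.1 h0
    · rw [typeI_at_iff (conf_pos hy.1).ne', typeI_at_killingSpinor_iff ε u hy.1]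
      exact htype
    · rw [hres _ u hK, hsv, hun, smul_smul, smul_smul]
      have h1 : 2 * (A / 2) = A := by ring
      have h2 : -2 * ((ε : ℤ) : ℝ) * (A / 2) * -((ε : ℤ) : ℝ) * A⁻¹ = 1 := by
        field_simp
        linear_combination hε
      rw [h1, ← mul_assoc, h2, one_smul]
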